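/- Let $N\ge 2$, $0<\alpha<1$, $\psi(t)=\frac{|t|^{1+\alpha}}{1+\alpha}$, write $x=(x',x_N)\in\mathbb R^{N-1}\times\mathbb R$, and let $\omega_{N-1}$ be the volume of the unit ball of $\mathbb R^{N-1}$. Call $\Omega\subset\mathbb R^N$ a model domain if it is a bounded domain (open, connected) of class $C^{1,\alpha}$ with $0\in\partial\Omega$ such that, for some $\eta>0$, $$\Omega\cap\{x_N<\eta\}=\{x:\ \psi(|x'|)<x_N<\eta\}.$$ For $u\in BV(\Omega)$ put $J_-(u)=\int_\Omega|Du|-\int_{\partial\Omega}|u|\,d\mathcal H_{N-1}$, where $u$ on $\partial\Omega$ denotes the boundary trace of $u$. Model domains exist for all $N\ge 2$ and $0<\alpha<1$, and every model domain $\Omega$ has the following properties. (i) Let $r_n>0$, $r_n\to0$, $E_n=\{x:\ \psi(|x'|)<x_N<\psi(r_n)\}$ and $v_n=r_n^{-(N-1+2\alpha)}\chi_{E_n}$. Then for all large $n$: $E_n\subset\Omega$, $v_n\in BV(\Omega)$, the trace of $v_n$ exists $\mathcal H_{N-1}$-almost everywhere on $\partial\Omega$ and is integrable on $\partial\Omega$,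 and $$\|v_n\|_{L^1(\Omega)}=\frac{\omega_{N-1}}{N+\alpha}\,r_n^{1-\alpha}.$$ In particular $v_n\to0$ in $L^1(\Omega)$. Moreover, as $n\to\infty$, $$J_-(v_n)=-\frac{(N-1)\,\omega_{N-1}}{2(N-1+2\alpha)}+O(r_n^{2\alpha}),$$ so there is a constant $c<0$ such that $J_-(v_n)\le c$ for all large $n$. (ii) $J_-$ is not lower semicontinuous on $BV(\Omega)$ with respect to the topology of $L^1(\Omega)$. (iii) Modica's semicontinuity result fails on $\Omega$: it is not true that for every Carathéodory function $F:\partial\Omega\times\mathbb R\to\mathbb R$ with $F(\cdot,0)\in L^1(\partial\Omega)$ and $|F(x,s)-F(x,t)|\le|s-t|$ for all $s,t\in\mathbb R$ and $\mathcal H_{N-1}$-almost all $x\in\partial\Omega$, the functional $J(u)=\int_\Omega|Du|+\int_{\partial\Omega}F(x,u)\,d\mathcal H_{N-1}$ is lower semicontinuous on $BV(\Omega)$ with respect to the topology of $L^1(\Omega)$. -/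

import Mathlib

open MeasureTheory Filter Topology Metric Set
open scoped ENNReal

noncomputable section

namespace BVTrace

/-- Euclidean space of dimension `n`. Below, the ambient space is `Euc (d + 1)`, so `N = d + 1`. -/
abbrev Euc (n : ℕ) : Type := EuclideanSpace ℝ (Fin n)

/-- The first `N - 1` coordinates `x' = (x_1, …, x_{N-1})` of `x ∈ ℝ^N`, where `N = d + 1`. -/
def hor {d : ℕ} (x : Euc (d + 1)) : Euc d := WithLp.toLp 2 (fun i => x i.castSucc)

/-- The last coordinate `x_N` of `x ∈ ℝ^N`, where `N = d + 1`. -/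
def vert {d : ℕ} (x : Euc (d + 1)) : ℝ := x (Fin.last d)

/-- The volume of the unit ball of `ℝ^d`. -/
def omega (d : ℕ) : ℝ := (volume (ball (0 : Euc d) 1)).toReal

/-! ### Domains with Hölder differentiable boundary -/

/-- `Ω ⊆ ℝ^N` is a bounded domain of class `C^{1,α}`: it is open, connected, nonempty and bounded,
and near each of its boundary points `x₀` it is, after a rigid motion carrying `x₀` to `0`, the
region above the graph of a differentiable function whose derivative is Hölder continuous with
exponent `α`. -/
structure IsBoundedC1Domain {d : ℕ} (α : ℝ) (Ω : Set (Euc (d + 1))) : Prop where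
  isOpen : IsOpen Ω
  isConnected : IsConnected Ω
  isBounded : Bornology.IsBounded Ω
  graph : ∀ x₀ ∈ frontier Ω, ∃ (T : Euc (d + 1) ≃ᵃⁱ[ℝ] Euc (d + 1)) (f : Euc d → ℝ) (ρ C : ℝ),
    0 < ρ ∧ T x₀ = 0 ∧
    (∀ s ∈ ball (0 : Euc d) ρ, DifferentiableAt ℝ f s) ∧
    (∀ s ∈ ball (0 : Euc d) ρ, ∀ t ∈ ball (0 : Euc d) ρ,
      ‖fderiv ℝ f s - fderiv ℝ f t‖ ≤ C * ‖s - t‖ ^ α) ∧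
    (∀ x ∈ ball x₀ ρ, x ∈ Ω ↔ f (hor (T x)) < vert (T x))

/-! ### Functions of bounded variation -/

/-- The divergence of a vector field on `ℝ^n`. -/
def divergence {n : ℕ} (φ : Euc n → Euc n) (x : Euc n) : ℝ :=
  ∑ i, (fderiv ℝ φ x (EuclideanSpace.single i 1)) i

/-- The vector fields of class `C^1` with compact support in `Ω` and with `|φ| ≤ 1`. -/
def testFields {n : ℕ} (Ω : Set (Euc n)) : Set (Euc n → Euc n) :=
  {φ | ContDiff ℝ 1 φ ∧ HasCompactSupport φ ∧ tsupport φ ⊆ Ω ∧ ∀ x, ‖φ x‖ ≤ 1}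

/-- The total variation `∫_Ω |Du| = ‖Du‖(Ω)`, a number in `[0, ∞]`, of an integrable function
`u` on the open set `Ω`. -/
def totalVariation {n : ℕ} (Ω : Set (Euc n)) (u : Euc n → ℝ) : ℝ≥0∞ :=
  ⨆ φ ∈ testFields Ω, ENNReal.ofReal (∫ x in Ω, u x * divergence φ x)

/-- `u ∈ BV(Ω)`; the values of `u` outside `Ω` play no role. -/
def MemBV {n : ℕ} (Ω : Set (Euc n)) (u : Euc n → ℝ) : Prop :=
  IntegrableOn u Ω ∧ totalVariation Ω u ≠ ∞

/-- The number `a` is the boundary trace at `x ∈ ∂Ω` of the function `u` on `Ω`: the mean value of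
`|u - a|` over `B(x, ρ) ∩ Ω` tends to `0` as `ρ → 0+`. -/
def HasTraceAt {n : ℕ} (Ω : Set (Euc n)) (u : Euc n → ℝ) (x : Euc n) (a : ℝ) : Prop :=
  Tendsto (fun ρ : ℝ => ⨍ y in ball x ρ ∩ Ω, |u y - a|) (𝓝[>] 0) (𝓝 0)

open Classical in
/-- The boundary trace of `u`, which for `u ∈ BV(Ω)` and a bounded Lipschitz domain `Ω` is defined
at `H_{N-1}`-almost every point of `∂Ω` (elsewhere the value `0` is put). -/
def trace {n : ℕ} (Ω : Set (Euc n)) (u : Euc n → ℝ) (x : Euc n) : ℝ :=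
  if h : ∃ a, HasTraceAt Ω u x a then h.choose else 0

/-- The surface measure on `∂Ω ⊆ ℝ^{d+1}`: the restriction to `∂Ω` of the `d`-dimensional Hausdorff
measure, normalized so that it agrees with Lebesgue measure on `ℝ^d`. -/
def surfaceMeasure {d : ℕ} (Ω : Set (Euc (d + 1))) : Measure (Euc (d + 1)) :=
  (μHE[d]).restrict (frontier Ω)

/-! ### The functionals -/

/-- `J_-(u) = ∫_Ω |Du| - ∫_{∂Ω} |u|`. -/
def Jminus {d : ℕ} (Ω : Set (Euc (d + 1))) (u : Euc (d + 1) → ℝ) : ℝ :=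
  (totalVariation Ω u).toReal - ∫ x, |trace Ω u x| ∂(surfaceMeasure Ω)

/-- `J(u) = ∫_Ω |Du| + ∫_{∂Ω} F(x, u)`. -/
def JF {d : ℕ} (Ω : Set (Euc (d + 1))) (F : Euc (d + 1) → ℝ → ℝ) (u : Euc (d + 1) → ℝ) : ℝ :=
  (totalVariation Ω u).toReal + ∫ x, F x (trace Ω u x) ∂(surfaceMeasure Ω)

/-- The functional `J` is lower semicontinuous on `BV(Ω)` with respect to the topology of
`L^1(Ω)`. -/
def IsLscBV {d : ℕ} (Ω : Set (Euc (d + 1))) (J : (Euc (d + 1) → ℝ) → ℝ) : Prop :=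
  LowerSemicontinuousOn (fun u : Lp ℝ 1 (volume.restrict Ω) => J u)
    {u : Lp ℝ 1 (volume.restrict Ω) | MemBV Ω u}

/-- Modica's semicontinuity property of `Ω`: whenever `F : ∂Ω × ℝ → ℝ` is a Carathéodory function
with `F(·, 0)` integrable on `∂Ω` and `|F(x,s) - F(x,t)| ≤ |s - t|` for all `s, t` and almost all
`x ∈ ∂Ω`, the functional `∫_Ω |Du| + ∫_{∂Ω} F(x, u)` is lower semicontinuous on `BV(Ω)` with respect
to the topology of `L^1(Ω)`. -/
def ModicaProperty {d : ℕ} (Ω : Set (Euc (d + 1))) : Prop :=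
  ∀ F : Euc (d + 1) → ℝ → ℝ,
    (∀ s, AEStronglyMeasurable (fun x => F x s) (surfaceMeasure Ω)) →
    (∀ᵐ x ∂(surfaceMeasure Ω), Continuous (F x)) →
    Integrable (fun x => F x 0) (surfaceMeasure Ω) →
    (∀ᵐ x ∂(surfaceMeasure Ω), ∀ s t, |F x s - F x t| ≤ |s - t|) →
    IsLscBV Ω (JF Ω F)

/-! ### The domain and the sequence of the example -/

/-- `ψ(t) = |t|^{1+α} / (1+α)`. -/
def psi (α t : ℝ) : ℝ := |t| ^ (1 + α) / (1 + α)

/-- `Ω` is a bounded `C^{1,α}` domain with `0 ∈ ∂Ω` which below the height `η > 0` is the region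
`ψ(|x'|) < x_N`. -/
structure IsModelDomain {d : ℕ} (α η : ℝ) (Ω : Set (Euc (d + 1))) : Prop where
  isC1 : IsBoundedC1Domain α Ω
  zero_mem : (0 : Euc (d + 1)) ∈ frontier Ω
  pos : 0 < η
  eq : Ω ∩ {x | vert x < η} = {x | psi α ‖hor x‖ < vert x ∧ vert x < η}

/-- The set `{x : ψ(|x'|) < x_N < ψ(r)}`. -/
def cap (d : ℕ) (α r : ℝ) : Set (Euc (d + 1)) :=
  {x | psi α ‖hor x‖ < vert x ∧ vert x < psi α r}

/-- The function `r^{-(N-1+2α)} χ_E` with `E = {x : ψ(|x'|) < x_N < ψ(r)}` and `N - 1 = d`. -/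
def capFun (d : ℕ) (α r : ℝ) : Euc (d + 1) → ℝ :=
  (cap d α r).indicator (fun _ => (r ^ ((d : ℝ) + 2 * α))⁻¹)

end BVTrace

end

/-! Write `d = N - 1`. The only part of the boundary of the cap inside `Ω` is the flat disc at
height `ψ(r)`, of area `ω r^d`, so the total variation of `capFun` sees just this disc
(`totalVariation_capFun`). The trace instead lives on the curved bottom, the graph of `ψ(|x'|)` over
the same disc (`integral_abs_trace_capFun`). The graph is larger than the disc: by the area formula
`graph_area` and `√(1+x) = 1 + x/2 + O(x²)` with `x = |x'|^(2α)`, the excess is a constant times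
`r^(d+2α)`, up to `O(r^(d+4α))` (`abs_graphArea_sub_le`). The normalization `r^(-(d+2α))` turns this
excess into a fixed negative limit of `J_-`. Since the cap has volume of order `r^(d+1+α)`, the
`L^1` norm is of order `r^(1-α)`, which tends to `0` because `α < 1`. As `J_-(0) = 0`,
semicontinuity fails at `0` (`not_isLscBV_of_seq`), and `J_-` is the Modica functional of `F(x, s) =
-|s|`.

The total variation is computed by duality: the divergence theorem on `{x_N < ψ(r)}` leaves the flux
through the disc, bounded by its area and nearly attained by cutoffs of the vertical unit field.

A model domain exists as the negative sublevel set of the convex function `modelFun`. A Hölder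
version of the implicit function theorem (`exists_implicit_graph`) supplies the local graphs. -/

noncomputable section

namespace BVTrace

section

/-! ### Splitting off the last coordinate -/

/-- The linear equivalence `x ↦ (x', x_N)`. -/
def splitₗ (d : ℕ) : Euc (d + 1) ≃ₗ[ℝ] Euc d × ℝ where
  toFun x := (hor x, vert x)
  invFun p := WithLp.toLp 2 (Fin.snoc (α := fun _ => ℝ) p.1 p.2)
  map_add' x y := by ext <;> simp [hor, vert]
  map_smul' c x := by ext <;> simp [hor, vert]
  left_inv x := by
    ext i
    refine Fin.lastCases ?_ (fun j => ?_) i <;> simp [hor, vert]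
  right_inv p := by
    ext <;> simp [hor, vert]

/-- The continuous linear equivalence `x ↦ (x', x_N)`. -/
def split (d : ℕ) : Euc (d + 1) ≃L[ℝ] Euc d × ℝ := (splitₗ d).toContinuousLinearEquiv

/-- The point with the given horizontal and vertical parts. -/
def join {d : ℕ} (s : Euc d) (t : ℝ) : Euc (d + 1) := (split d).symm (s, t)

variable {d : ℕ}

lemma split_apply (x : Euc (d + 1)) : split d x = (hor x, vert x) := rfl

@[simp] lemma hor_join (s : Euc d) (t : ℝ) : hor (join s t) = s :=
  congrArg Prod.fst ((split d).apply_symm_apply (s, t))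

@[simp] lemma vert_join (s : Euc d) (t : ℝ) : vert (join s t) = t :=
  congrArg Prod.snd ((split d).apply_symm_apply (s, t))

@[simp] lemma join_hor_vert (x : Euc (d + 1)) : join (hor x) (vert x) = x :=
  (split d).symm_apply_apply x

lemma join_apply_last (s : Euc d) (t : ℝ) : (join s t) (Fin.last d) = t := vert_join s t

lemma join_apply_castSucc (s : Euc d) (t : ℝ) (i : Fin d) : (join s t) i.castSucc = s i :=
  congrArg (fun v : Euc d => v i) (hor_join s t)

/-- The horizontal part as a continuous linear map. -/
def horL (d : ℕ) : Euc (d + 1) →L[ℝ] Euc d :=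
  (ContinuousLinearMap.fst ℝ (Euc d) ℝ).comp (split d : Euc (d + 1) →L[ℝ] Euc d × ℝ)

/-- The vertical part as a continuous linear map. -/
def vertL (d : ℕ) : Euc (d + 1) →L[ℝ] ℝ :=
  (ContinuousLinearMap.snd ℝ (Euc d) ℝ).comp (split d : Euc (d + 1) →L[ℝ] Euc d × ℝ)

@[simp] lemma horL_apply (x : Euc (d + 1)) : horL d x = hor x := rfl
@[simp] lemma vertL_apply (x : Euc (d + 1)) : vertL d x = vert x := rfl

@[fun_prop] lemma continuous_hor : Continuous (hor : Euc (d + 1) → Euc d) := (horL d).continuous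
@[fun_prop] lemma continuous_vert : Continuous (vert : Euc (d + 1) → ℝ) := (vertL d).continuous
@[fun_prop] lemma measurable_hor : Measurable (hor : Euc (d + 1) → Euc d) :=
  continuous_hor.measurable
@[fun_prop] lemma measurable_vert : Measurable (vert : Euc (d + 1) → ℝ) :=
  continuous_vert.measurable

@[fun_prop] lemma continuous_join {X : Type*} [TopologicalSpace X] {f : X → Euc d} {g : X → ℝ}
    (hf : Continuous f) (hg : Continuous g) : Continuous fun x => join (f x) (g x) :=
  (split d).symm.continuous.comp (hf.prodMk hg)

lemma hor_sub (x y : Euc (d + 1)) : hor (x - y) = hor x - hor y := (horL d).map_sub x y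
lemma vert_sub (x y : Euc (d + 1)) : vert (x - y) = vert x - vert y := (vertL d).map_sub x y
@[simp] lemma hor_zero : hor (0 : Euc (d + 1)) = 0 := (horL d).map_zero
@[simp] lemma vert_zero : vert (0 : Euc (d + 1)) = 0 := (vertL d).map_zero

lemma norm_sq_eq (x : Euc (d + 1)) : ‖x‖ ^ 2 = ‖hor x‖ ^ 2 + vert x ^ 2 := by
  simp [EuclideanSpace.norm_sq_eq, Fin.sum_univ_castSucc, hor, vert]

lemma norm_hor_le (x : Euc (d + 1)) : ‖hor x‖ ≤ ‖x‖ := by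
  refine le_of_sq_le_sq ?_ (norm_nonneg _)
  nlinarith [norm_sq_eq x, sq_nonneg (vert x)]

lemma abs_vert_le (x : Euc (d + 1)) : |vert x| ≤ ‖x‖ :=
  abs_le_of_sq_le_sq (by nlinarith [norm_sq_eq x, sq_nonneg ‖hor x‖]) (norm_nonneg _)

lemma measurePreserving_split :
    MeasurePreserving (split d) (volume : Measure (Euc (d + 1))) (volume.prod volume) := by
  have h1 := PiLp.volume_preserving_ofLp (Fin (d + 1))
  have h2 := volume_preserving_piFinSuccAbove (fun _ : Fin (d + 1) => ℝ) (Fin.last d)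
  have h3 := PiLp.volume_preserving_toLp (Fin d)
  have h4 : MeasurePreserving Prod.swap (volume.prod volume : Measure (ℝ × (Fin d → ℝ)))
    (volume.prod volume) := Measure.measurePreserving_swap
  -- `piFinSuccAbove` puts the removed coordinate first, hence the swap.
  have h5 := (h3.prod (MeasurePreserving.id (volume : Measure ℝ))).comp (h4.comp (h2.comp h1))
  have e : ⇑(split d) = Prod.map (WithLp.toLp 2) id ∘
      Prod.swap ∘ (MeasurableEquiv.piFinSuccAbove (fun _ => ℝ) (Fin.last d)) ∘ WithLp.ofLp := by
    funext x
    refine Prod.ext ?_ rfl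
    ext i
    simp [split_apply, hor, MeasurableEquiv.piFinSuccAbove, Fin.init]
  rw [e]
  exact h5

lemma integral_join {F : Type*} [NormedAddCommGroup F] [NormedSpace ℝ F] (g : Euc (d + 1) → F) :
    ∫ x, g x = ∫ p : Euc d × ℝ, g (join p.1 p.2) ∂(volume.prod volume) := by
  rw [← (measurePreserving_split (d := d)).integral_comp
    (split d).toHomeomorph.measurableEmbedding]
  simp [split_apply]

lemma integrable_join_iff {F : Type*} [NormedAddCommGroup F] (g : Euc (d + 1) → F) :
    Integrable (fun p : Euc d × ℝ => g (join p.1 p.2)) (volume.prod volume) ↔ Integrable g := by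
  rw [← (measurePreserving_split (d := d)).integrable_comp_emb
    (split d).toHomeomorph.measurableEmbedding]
  simp [Function.comp_def, split_apply]

end

section

variable {d : ℕ}

/-! ### The area of a graph -/

/-- The hypothesis makes `g` constant on the fibres of `h` in `A`, so `g` factors on `A` through a
`c`-Lipschitz map of `h '' A`. This compares two parametrizations without assuming either injective.
-/
lemma euclideanHausdorffMeasure_image_le_image {X Y Z : Type*} [EMetricSpace Y]
    [MeasurableSpace Y] [BorelSpace Y] [EMetricSpace Z] [MeasurableSpace Z] [BorelSpace Z]
    {g : X → Y} {h : X → Z} {A : Set X} {c : NNReal} (n : ℕ)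
    (H : ∀ x ∈ A, ∀ y ∈ A, edist (g x) (g y) ≤ c * edist (h x) (h y)) :
    μHE[n] (g '' A) ≤ (c : ℝ≥0∞) ^ n * μHE[n] (h '' A) := by
  rcases A.eq_empty_or_nonempty with rfl | ⟨a, ha⟩
  · simp
  have : Nonempty X := ⟨a⟩
  set φ : Z → Y := g ∘ Function.invFunOn h A
  have key : ∀ x ∈ A, Function.invFunOn h A (h x) ∈ A ∧ h (Function.invFunOn h A (h x)) = h x :=
    fun x hx => ⟨Function.invFunOn_mem ⟨x, hx, rfl⟩, Function.invFunOn_eq ⟨x, hx, rfl⟩⟩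
  have hφ : LipschitzOnWith c φ (h '' A) := by
    rintro _ ⟨x, hx, rfl⟩ _ ⟨y, hy, rfl⟩
    have := H _ (key x hx).1 _ (key y hy).1
    rwa [(key x hx).2, (key y hy).2] at this
  have hs : g '' A = φ '' (h '' A) := by
    rw [image_image]
    refine image_congr fun x hx => ?_
    have := H _ hx _ (key x hx).1
    rw [(key x hx).2, edist_self, mul_zero, nonpos_iff_eq_zero, edist_eq_zero] at this
    exact this
  have := hφ.hausdorffMeasure_image_le (d := n) n.cast_nonneg
  rw [hs, Measure.euclideanHausdorffMeasure_def, Measure.euclideanHausdorffMeasure_def,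
    Measure.smul_apply, Measure.smul_apply, ENNReal.smul_def, ENNReal.smul_def, smul_eq_mul,
    smul_eq_mul, mul_left_comm]
  gcongr
  simpa using this

/-- The linear map of the base which distorts lengths as the graph of `ℓ` does. -/
lemma exists_linearMap_norm_sq_eq (ℓ : Euc d →L[ℝ] ℝ) :
    ∃ S : Euc d →ₗ[ℝ] Euc d, (∀ v, ‖S v‖ ^ 2 = ‖v‖ ^ 2 + ℓ v ^ 2) ∧
      LinearMap.det S = √(1 + ‖ℓ‖ ^ 2) := by
  set a : Euc d := (InnerProductSpace.toDual ℝ (Euc d)).symm ℓ with ha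
  have hℓ : ∀ v, inner ℝ a v = ℓ v := fun v => InnerProductSpace.toDual_symm_apply
  have hn : ‖a‖ = ‖ℓ‖ := LinearIsometryEquiv.norm_map _ _
  set q := √(1 + ‖ℓ‖ ^ 2) with hq
  have hq2 : q ^ 2 = 1 + ‖ℓ‖ ^ 2 := Real.sq_sqrt (by positivity)
  have hq0 : 0 ≤ q := Real.sqrt_nonneg _
  have hq1 : (1 + q) ≠ 0 := by positivity
  -- This is the symmetric square root of `I + a ⊗ a`: it fixes the orthogonal complement of `a` and
  -- scales `a` by `1 + |a|²/(1+q) = q`, because `|a|² = q² - 1`.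
  refine ⟨LinearMap.transvection (ℓ : Euc d →ₗ[ℝ] ℝ) ((1 + q)⁻¹ • a), fun v => ?_, ?_⟩
  · have : LinearMap.transvection (ℓ : Euc d →ₗ[ℝ] ℝ) ((1 + q)⁻¹ • a) v
        = v + (ℓ v * (1 + q)⁻¹) • a := by
      simp [LinearMap.transvection.apply, smul_smul]
    rw [this, norm_add_sq_real, inner_smul_right, real_inner_comm, hℓ, norm_smul, hn, mul_pow,
      Real.norm_eq_abs, sq_abs]
    have : ‖ℓ‖ ^ 2 = q ^ 2 - 1 := by linarith
    rw [this]
    field_simp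
    ring
  · rw [LinearMap.transvection.det]
    have : ℓ ((1 + q)⁻¹ • a) = (1 + q)⁻¹ * ‖ℓ‖ ^ 2 := by
      rw [map_smul, ← hℓ a, real_inner_self_eq_norm_sq, hn, smul_eq_mul]
    change 1 + ℓ ((1 + q)⁻¹ • a) = q
    rw [this]
    have : ‖ℓ‖ ^ 2 = q ^ 2 - 1 := by linarith
    rw [this]
    field_simp
    ring

/-- The graph of `f` over `A`. -/
def graphOver (f : Euc d → ℝ) (A : Set (Euc d)) : Set (Euc (d + 1)) :=
  {x | hor x ∈ A ∧ vert x = f (hor x)}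

lemma graphOver_eq_image (f : Euc d → ℝ) (A : Set (Euc d)) :
    graphOver f A = (fun s => join s (f s)) '' A := by
  ext x
  constructor
  · rintro ⟨h1, h2⟩
    exact ⟨hor x, h1, by simp [← h2]⟩
  · rintro ⟨s, hs, rfl⟩
    simpa [graphOver] using hs

lemma join_sub_join (s s' : Euc d) (t t' : ℝ) :
    join s t - join s' t' = join (s - s') (t - t') := by
  rw [← join_hor_vert (join s t - join s' t'), hor_sub, vert_sub]
  simp

lemma norm_join_sq (s : Euc d) (t : ℝ) : ‖join s t‖ ^ 2 = ‖s‖ ^ 2 + t ^ 2 := by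
  simp [norm_sq_eq]

lemma norm_le_norm_join (s : Euc d) (t : ℝ) : ‖s‖ ≤ ‖join s t‖ := by
  simpa using norm_hor_le (join s t)

lemma norm_join_le (s : Euc d) (t : ℝ) : ‖join s t‖ ≤ ‖s‖ + |t| := by
  refine le_of_sq_le_sq ?_ (by positivity)
  rw [norm_join_sq]
  nlinarith [sq_abs t, mul_nonneg (norm_nonneg s) (abs_nonneg t)]

/-- Near a point of strict differentiability, the area of the graph is comparable to the area of
the graph of the linearization. -/
lemma graph_area_local {f : Euc d → ℝ} {ℓ : Euc d →L[ℝ] ℝ} {x : Euc d}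
    (hf : HasStrictFDerivAt f ℓ x) {c : NNReal} (hc : 1 < c) :
    ∃ s ∈ 𝓝 x, ∀ A ⊆ s,
      μHE[d] (graphOver f A) ≤ (c : ℝ≥0∞) ^ d * (ENNReal.ofReal √(1 + ‖ℓ‖ ^ 2) * volume A) ∧
      ENNReal.ofReal √(1 + ‖ℓ‖ ^ 2) * volume A ≤ (c : ℝ≥0∞) ^ d * μHE[d] (graphOver f A) := by
  obtain ⟨S, hS, hdet⟩ := exists_linearMap_norm_sq_eq ℓ
  have hc' : (0 : NNReal) < c - 1 := tsub_pos_of_lt hc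
  have hcc : ((c - 1 : NNReal) : ℝ) = c - 1 := by rw [NNReal.coe_sub hc.le]; simp
  obtain ⟨s, hs, hs'⟩ := hf.approximates_deriv_on_nhds (c := c - 1) (Or.inr hc')
  have hvol : ∀ A : Set (Euc d),
      μHE[d] (S '' A) = ENNReal.ofReal √(1 + ‖ℓ‖ ^ 2) * volume A := fun A => by
    rw [EuclideanSpace.euclideanHausdorffMeasure_eq_volume, Measure.addHaar_image_linearMap, hdet,
      abs_of_nonneg (Real.sqrt_nonneg _)]
  -- The linearization error is at most `(c - 1)‖w‖`, and `‖w‖` is at most the length of either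
  -- lifted vector; so the two lengths differ by a factor of at most `c`.
  have key : ∀ y ∈ s, ∀ z ∈ s,
      ‖join y (f y) - join z (f z)‖ ≤ c * ‖S y - S z‖ ∧
      ‖S y - S z‖ ≤ c * ‖join y (f y) - join z (f z)‖ := by
    intro y hy z hz
    have h1 : |f y - f z - ℓ (y - z)| ≤ (c - 1) * ‖y - z‖ := by
      have := hs' y hy z hz
      rwa [hcc] at this
    rw [← map_sub, join_sub_join]
    set w := y - z
    have h2 : ‖S w‖ = ‖join w (ℓ w)‖ := by
      rw [← sq_eq_sq₀ (norm_nonneg _) (norm_nonneg _), hS, norm_join_sq]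
    have h3 : ‖join w (f y - f z) - join w (ℓ w)‖ ≤ (c - 1) * ‖w‖ := by
      rw [join_sub_join, sub_self]
      exact (norm_join_le _ _).trans (by simpa using h1)
    have h4 := norm_le_norm_join w (f y - f z)
    have h5 := norm_le_norm_join w (ℓ w)
    have h6 := norm_sub_norm_le (join w (f y - f z)) (join w (ℓ w))
    have h7 := norm_sub_norm_le (join w (ℓ w)) (join w (f y - f z))
    rw [norm_sub_rev] at h7
    have : (0 : ℝ) ≤ c - 1 := by rw [← hcc]; positivity
    rw [h2]
    constructor <;> nlinarith [mul_le_mul_of_nonneg_left h4 this, mul_le_mul_of_nonneg_left h5 this]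
  have hed : ∀ {a b : ℝ}, a ≤ c * b → 0 ≤ b →
      ENNReal.ofReal a ≤ c * ENNReal.ofReal b := fun h hb => by
    refine (ENNReal.ofReal_le_ofReal h).trans_eq ?_
    rw [ENNReal.ofReal_mul c.coe_nonneg, ENNReal.ofReal_coe_nnreal]
  refine ⟨s, hs, fun A hA => ?_⟩
  rw [← hvol, graphOver_eq_image]
  constructor
  · refine euclideanHausdorffMeasure_image_le_image d fun y hy z hz => ?_
    rw [edist_dist, edist_dist, dist_eq_norm, dist_eq_norm]
    exact hed (key y (hA hy) z (hA hz)).1 (norm_nonneg _)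
  · refine euclideanHausdorffMeasure_image_le_image d fun y hy z hz => ?_
    rw [edist_dist, edist_dist, dist_eq_norm, dist_eq_norm]
    exact hed (key y (hA hy) z (hA hz)).2 (norm_nonneg _)

/-- A crude bound, needed only for absolute continuity in `graph_area` and for finiteness of the
area. -/
lemma graph_area_le_of_lipschitz {f : Euc d → ℝ} {K : NNReal} {A : Set (Euc d)}
    (hf : LipschitzOnWith K f A) :
    μHE[d] (graphOver f A) ≤ ((1 + K : NNReal) : ℝ≥0∞) ^ d * volume A := by
  have := euclideanHausdorffMeasure_image_le_image (g := fun s => join s (f s)) (h := id) (A := A)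
    (c := 1 + K) d (fun y hy z hz => by
      rw [edist_dist, edist_dist, dist_eq_norm, dist_eq_norm, join_sub_join,
        ← ENNReal.ofReal_coe_nnreal, ← ENNReal.ofReal_mul (NNReal.coe_nonneg _)]
      refine ENNReal.ofReal_le_ofReal ((norm_join_le _ _).trans ?_)
      have := hf.dist_le_mul y hy z hz
      rw [Real.dist_eq, dist_eq_norm] at this
      push_cast
      simp only [id]
      linarith)
  rwa [← graphOver_eq_image, image_id, EuclideanSpace.euclideanHausdorffMeasure_eq_volume] at this

/-- The area formula for graphs. -/
theorem graph_area {f : Euc d → ℝ} {U : Set (Euc d)} (hU : IsOpen U)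
    {K : NNReal} (hf : LipschitzOnWith K f U) {ℓ : Euc d → (Euc d →L[ℝ] ℝ)}
    (hℓ : ∀ᵐ x : Euc d, x ∈ U → HasStrictFDerivAt f (ℓ x) x)
    {A : Set (Euc d)} (hA : MeasurableSet A) (hAU : A ⊆ U) :
    μHE[d] (graphOver f A) = ∫⁻ s in A, ENNReal.ofReal √(1 + ‖ℓ s‖ ^ 2) := by
  -- The surface measure projected to the base. It is dominated by a multiple of Lebesgue measure,
  -- so it is the integral of its density, which is found by differentiation along balls.
  set ν : Measure (Euc d) := (μHE[d].restrict (graphOver f U)).map hor with hν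
  have hνA : ∀ B, MeasurableSet B → ν B = μHE[d] (graphOver f (B ∩ U)) := fun B hB => by
    rw [hν, Measure.map_apply measurable_hor hB, Measure.restrict_apply (measurable_hor hB)]
    congr 1
    ext x
    simp [graphOver, and_assoc]
  have hνle : ν ≤ ((1 + K) ^ d : NNReal) • (volume : Measure (Euc d)) := by
    refine Measure.le_iff.2 fun B hB => ?_
    rw [hνA B hB]
    refine (graph_area_le_of_lipschitz (hf.mono inter_subset_right)).trans ?_
    rw [Measure.smul_apply, ENNReal.smul_def, smul_eq_mul]
    push_cast
    gcongr
    exact inter_subset_left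
  have hac : ν ≪ volume :=
    (Measure.absolutelyContinuous_of_le hνle).trans
      (Measure.smul_absolutelyContinuous (c := ((1 + K) ^ d : NNReal)))
  have : IsLocallyFiniteMeasure ν := Measure.isLocallyFiniteMeasure_of_le hνle
  have hrn : ∀ᵐ x : Euc d, x ∈ U → ν.rnDeriv volume x = ENNReal.ofReal √(1 + ‖ℓ x‖ ^ 2) := by
    filter_upwards [Besicovitch.ae_tendsto_rnDeriv ν volume, hℓ] with x hx hx' hxU
    set q := ENNReal.ofReal √(1 + ‖ℓ x‖ ^ 2) with hq
    have hbd : ∀ c : NNReal, 1 < c →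
        ν.rnDeriv volume x ≤ (c : ℝ≥0∞) ^ d * q ∧ q ≤ (c : ℝ≥0∞) ^ d * ν.rnDeriv volume x := by
      intro c hc
      obtain ⟨s, hs, hs'⟩ := graph_area_local (hx' hxU) hc
      have hev : ∀ᶠ r in 𝓝[>] (0 : ℝ), closedBall x r ⊆ s ∩ U := by
        obtain ⟨ε, hε, h⟩ := Metric.nhds_basis_closedBall.mem_iff.1
          (inter_mem hs (hU.mem_nhds hxU))
        filter_upwards [Ioo_mem_nhdsGT hε] with r hr
        exact (closedBall_subset_closedBall hr.2.le).trans h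
      have hev2 : ∀ᶠ r in 𝓝[>] (0 : ℝ),
          ν (closedBall x r) / volume (closedBall x r) ≤ (c : ℝ≥0∞) ^ d * q ∧
          q ≤ (c : ℝ≥0∞) ^ d * (ν (closedBall x r) / volume (closedBall x r)) := by
        filter_upwards [hev, self_mem_nhdsWithin] with r hr hr0
        have h0 : volume (closedBall x r) ≠ 0 := (measure_closedBall_pos _ _ hr0).ne'
        have ht : volume (closedBall x r) ≠ ∞ := measure_closedBall_lt_top.ne
        rw [hνA _ measurableSet_closedBall,
          inter_eq_self_of_subset_left (hr.trans inter_subset_right)]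
        obtain ⟨h1, h2⟩ := hs' _ (hr.trans inter_subset_left)
        constructor
        · rw [ENNReal.div_le_iff h0 ht, mul_assoc]
          exact h1
        · rw [← mul_div_assoc, ENNReal.le_div_iff_mul_le (Or.inl h0) (Or.inl ht)]
          exact h2
      refine ⟨le_of_tendsto hx (hev2.mono fun _ h => h.1), ?_⟩
      have hc0 : (c : ℝ≥0∞) ^ d ≠ ∞ := by simp
      exact ge_of_tendsto (ENNReal.Tendsto.const_mul hx (Or.inr hc0)) (hev2.mono fun _ h => h.2)
    -- Letting `c` decrease to `1` closes the gap between the two bounds on the density.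
    have hlim : ∀ b : ℝ≥0∞,
        Tendsto (fun c : NNReal => (c : ℝ≥0∞) ^ d * b) (𝓝[>] 1) (𝓝 b) := by
      intro b
      have h1 : Tendsto (fun c : NNReal => ((c ^ d : NNReal) : ℝ≥0∞)) (𝓝[>] 1) (𝓝 1) := by
        have : Tendsto (fun c : NNReal => c ^ d) (𝓝[>] 1) (𝓝 (1 ^ d)) :=
          ((continuous_pow d).tendsto 1).mono_left nhdsWithin_le_nhds
        rw [one_pow] at this
        exact ENNReal.tendsto_coe.2 this
      simpa using ENNReal.Tendsto.mul_const h1 (Or.inl one_ne_zero) (b := b)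
    apply le_antisymm
    · exact ge_of_tendsto (hlim q) (by
        filter_upwards [self_mem_nhdsWithin] with c hc using (hbd c hc).1)
    · exact ge_of_tendsto (hlim _) (by
        filter_upwards [self_mem_nhdsWithin] with c hc using (hbd c hc).2)
  have h1 := Measure.setLIntegral_rnDeriv hac A
  rw [hνA A hA, inter_eq_self_of_subset_left hAU] at h1
  rw [← h1]
  refine setLIntegral_congr_fun_ae hA ?_
  filter_upwards [hrn] with x hx hxA using hx (hAU hxA)

end

section

variable {d : ℕ} {α : ℝ}

/-! ### The profile `s ↦ ψ(|s|)` -/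

/-- The function `s ↦ ψ(|s|)` on `ℝ^d`. -/
def profile (d : ℕ) (α : ℝ) (s : Euc d) : ℝ := psi α ‖s‖

/-- The derivative of `s ↦ ψ(|s|)`. -/
def profileDeriv (d : ℕ) (α : ℝ) (s : Euc d) : Euc d →L[ℝ] ℝ := ‖s‖ ^ (α - 1) • innerSL ℝ s

lemma profile_eq (s : Euc d) : profile d α s = ‖s‖ ^ (1 + α) / (1 + α) := by
  simp [profile, psi]

lemma contDiff_profile (hα : 0 < α) : ContDiff ℝ 1 (profile d α) := by
  have : profile d α = fun s => ‖s‖ ^ (1 + α) / (1 + α) := funext profile_eq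
  rw [this]
  exact (contDiff_norm_rpow (by linarith)).div_const _

lemma hasFDerivAt_profile (hα : 0 < α) (s : Euc d) :
    HasFDerivAt (profile d α) (profileDeriv d α s) s := by
  have h := (hasFDerivAt_norm_rpow s (p := 1 + α) (by linarith)).mul_const (1 + α)⁻¹
  have : profile d α = fun s => ‖s‖ ^ (1 + α) * (1 + α)⁻¹ :=
    funext fun s => by rw [profile_eq, div_eq_mul_inv]
  rw [this]
  refine h.congr_fderiv ?_
  rw [smul_smul, show 1 + α - 2 = α - 1 by ring, ← mul_assoc,
    inv_mul_cancel₀ (by linarith), one_mul]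
  rfl

lemma hasStrictFDerivAt_profile (hα : 0 < α) (s : Euc d) :
    HasStrictFDerivAt (profile d α) (profileDeriv d α s) s :=
  (contDiff_profile hα).contDiffAt.hasStrictFDerivAt' (hasFDerivAt_profile hα s) one_ne_zero

lemma norm_profileDeriv (hα : 0 < α) (s : Euc d) : ‖profileDeriv d α s‖ = ‖s‖ ^ α := by
  rw [profileDeriv, norm_smul, innerSL_apply_norm, Real.norm_eq_abs,
    abs_of_nonneg (by positivity)]
  rcases eq_or_ne s 0 with rfl | hs
  · simp [Real.zero_rpow hα.ne']
  · rw [← Real.rpow_add_one (norm_ne_zero_iff.2 hs), sub_add_cancel]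

/-- With `|t| ≤ |s|`, split the difference of the gradients as `|s|^(α-1) (s - t) + (|s|^(α-1) -
|t|^(α-1)) t`. Each term is at most `|s|^(α-1) |s - t|`, which is at most `2 |s - t|^α` since `|s| ≥
|s - t|/2`. -/
lemma norm_profileDeriv_sub_le (hα0 : 0 < α) (hα1 : α < 1) (s t : Euc d) :
    ‖profileDeriv d α s - profileDeriv d α t‖ ≤ 4 * ‖s - t‖ ^ α := by
  wlog hst : ‖t‖ ≤ ‖s‖ generalizing s t
  · rw [norm_sub_rev, norm_sub_rev s]
    exact this t s (le_of_not_ge hst)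
  rcases eq_or_ne s 0 with rfl | hs
  · have : t = 0 := norm_le_zero_iff.1 (by simpa using hst)
    simp [this, Real.zero_rpow hα0.ne']
  rcases eq_or_ne s t with rfl | hne
  · simp [Real.zero_rpow hα0.ne']
  have hs0 : 0 < ‖s‖ := norm_pos_iff.2 hs
  have hd0 : 0 < ‖s - t‖ := norm_pos_iff.2 (sub_ne_zero.2 hne)
  have hd2 : ‖s - t‖ / 2 ≤ ‖s‖ := by linarith [norm_sub_le s t]
  have h1 : ‖s‖ ^ (α - 1) * ‖s - t‖ ≤ 2 * ‖s - t‖ ^ α := by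
    calc ‖s‖ ^ (α - 1) * ‖s - t‖ ≤ (‖s - t‖ / 2) ^ (α - 1) * ‖s - t‖ := by
          gcongr ?_ * _
          exact Real.rpow_le_rpow_of_nonpos (by positivity) hd2 (by linarith)
      _ = 2 ^ (1 - α) * ‖s - t‖ ^ α := by
          rw [Real.div_rpow hd0.le (by norm_num), show 1 - α = -(α - 1) by ring,
            Real.rpow_neg (by norm_num), Real.rpow_sub_one hd0.ne']
          field_simp
      _ ≤ 2 * ‖s - t‖ ^ α := by
          gcongr
          calc (2 : ℝ) ^ (1 - α) ≤ 2 ^ (1 : ℝ) := by gcongr <;> linarith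
            _ = 2 := Real.rpow_one 2
  have h2 : |‖s‖ ^ (α - 1) - ‖t‖ ^ (α - 1)| * ‖t‖ ≤ ‖s‖ ^ (α - 1) * ‖s - t‖ := by
    rcases eq_or_ne t 0 with rfl | ht
    · simp only [norm_zero, mul_zero, sub_zero]
      positivity
    have ht0 : 0 < ‖t‖ := norm_pos_iff.2 ht
    have h3 : ‖s‖ ^ (α - 1) ≤ ‖t‖ ^ (α - 1) :=
      Real.rpow_le_rpow_of_nonpos ht0 hst (by linarith)
    have h4 : ‖t‖ ^ α ≤ ‖s‖ ^ α := by gcongr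
    have h5 : ∀ x : ℝ, 0 < x → x ^ (α - 1) * x = x ^ α := fun x hx => by
      rw [← Real.rpow_add_one hx.ne', sub_add_cancel]
    rw [abs_of_nonpos (by linarith)]
    have h6 : ‖s‖ ^ (α - 1) * (‖s‖ - ‖t‖) ≤ ‖s‖ ^ (α - 1) * ‖s - t‖ := by
      gcongr
      exact norm_sub_norm_le s t
    nlinarith [h5 _ hs0, h5 _ ht0]
  have h7 : profileDeriv d α s - profileDeriv d α t =
      innerSL ℝ (‖s‖ ^ (α - 1) • (s - t) + (‖s‖ ^ (α - 1) - ‖t‖ ^ (α - 1)) • t) := by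
    simp only [profileDeriv, map_add, map_smul, map_sub, smul_sub, sub_smul]
    abel
  rw [h7, innerSL_apply_norm]
  refine (norm_add_le _ _).trans ?_
  rw [norm_smul, norm_smul, Real.norm_eq_abs, Real.norm_eq_abs, abs_of_nonneg (by positivity)]
  linarith

lemma psi_nonneg (hα : 0 < α) (t : ℝ) : 0 ≤ psi α t := by
  unfold psi; positivity

lemma psi_lt_psi (hα : 0 < α) {s t : ℝ} (hs : 0 ≤ s) (hst : s < t) : psi α s < psi α t := by
  unfold psi
  rw [abs_of_nonneg hs, abs_of_nonneg (hs.trans hst.le)]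
  gcongr

lemma psi_lt_psi_iff (hα : 0 < α) {s t : ℝ} (hs : 0 ≤ s) (ht : 0 ≤ t) :
    psi α s < psi α t ↔ s < t :=
  ⟨fun h => lt_of_not_ge fun h' => by
    rcases h'.eq_or_lt with rfl | h'
    · exact lt_irrefl _ h
    · exact lt_asymm h (psi_lt_psi hα ht h'), psi_lt_psi hα hs⟩

lemma continuous_psi (hα : 0 < α) : Continuous (psi α) := by
  unfold psi
  exact (continuous_abs.rpow_const fun _ => Or.inr (by linarith)).div_const _

lemma psi_zero (hα : 0 < α) : psi α 0 = 0 := by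
  simp [psi, Real.zero_rpow (by linarith : 1 + α ≠ 0)]

lemma lipschitzOnWith_profile (hα : 0 < α) (R : ℝ) :
    LipschitzOnWith (R ^ α).toNNReal (profile d α) (ball 0 R) := by
  refine (convex_ball (0 : Euc d) R).lipschitzOnWith_of_nnnorm_hasFDerivWithin_le
    (fun s _ => (hasFDerivAt_profile hα s).hasFDerivWithinAt) fun s hs => ?_
  rw [← NNReal.coe_le_coe, coe_nnnorm, norm_profileDeriv hα, Real.coe_toNNReal']
  refine le_max_of_le_left ?_
  have : ‖s‖ < R := by simpa using hs
  gcongr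

/-! ### Radial integrals -/

lemma integral_ball_norm_rpow (hd : 1 ≤ d) {β r : ℝ} (hβ : 0 ≤ β) (hr : 0 ≤ r) :
    ∫ s in ball (0 : Euc d) r, ‖s‖ ^ β = d * omega d / (d + β) * r ^ ((d : ℝ) + β) := by
  have : NeZero d := ⟨by omega⟩
  have hd' : (1 : ℝ) ≤ d := by exact_mod_cast hd
  have h1 : ∫ s in ball (0 : Euc d) r, ‖s‖ ^ β
      = ∫ s : Euc d, (Iio r).indicator (fun t : ℝ => t ^ β) ‖s‖ := by
    rw [← integral_indicator measurableSet_ball]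
    congr 1 with s
    by_cases h : ‖s‖ < r <;> simp [indicator, h]
  rw [h1, integral_fun_norm_addHaar volume, finrank_euclideanSpace_fin]
  have h2 : ∫ y in Ioi (0 : ℝ), y ^ (d - 1) • (Iio r).indicator (fun t : ℝ => t ^ β) y
      = ∫ y in (0 : ℝ)..r, y ^ ((d : ℝ) - 1 + β) := by
    rw [intervalIntegral.integral_of_le hr, integral_Ioc_eq_integral_Ioo,
      ← Ioi_inter_Iio, ← setIntegral_indicator measurableSet_Iio]
    refine setIntegral_congr_fun measurableSet_Ioi fun y hy => ?_
    by_cases h : y < r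
    · simp only [indicator, mem_Iio, h, if_true, smul_eq_mul]
      -- `1 ≤ d` makes the truncated exponent `d - 1` agree with the real one.
      rw [Real.rpow_add hy, ← Real.rpow_natCast, Nat.cast_sub hd, Nat.cast_one]
    · simp [indicator, h]
  rw [h2, integral_rpow (Or.inl (by linarith))]
  rw [Real.zero_rpow (by linarith), show (d : ℝ) - 1 + β + 1 = d + β by ring]
  simp [omega, Measure.real]
  ring

lemma integrableOn_ball_norm_rpow {β r : ℝ} (hβ : 0 ≤ β) :
    IntegrableOn (fun s : Euc d => ‖s‖ ^ β) (ball 0 r) :=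
  ((continuous_norm.rpow_const fun _ => Or.inr hβ).continuousOn.integrableOn_compact
    (isCompact_closedBall 0 r)).mono_set ball_subset_closedBall

lemma volume_real_ball (hd : 1 ≤ d) {r : ℝ} (hr : 0 ≤ r) :
    (volume : Measure (Euc d)).real (ball 0 r) = omega d * r ^ (d : ℝ) := by
  have : NeZero d := ⟨by omega⟩
  rw [Measure.real, Measure.addHaar_ball _ _ hr, finrank_euclideanSpace_fin, ENNReal.toReal_mul,
    ENNReal.toReal_ofReal (by positivity), omega, Real.rpow_natCast, mul_comm]

/-! ### Expansion of the graph area and volume of the cap -/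

lemma abs_sqrt_one_add_sub_le {x : ℝ} (hx : 0 ≤ x) : |√(1 + x) - 1 - x / 2| ≤ x ^ 2 / 8 := by
  have h := Real.sq_sqrt (by linarith : 0 ≤ 1 + x)
  have h1 : 1 ≤ √(1 + x) := Real.one_le_sqrt.2 (by linarith)
  set q := √(1 + x)
  -- In terms of `q` the error is exactly `-(q - 1)²/2`, while `x²/8 = (q - 1)² (q + 1)²/8` and `(q
  -- + 1)² ≥ 4`.
  have hx' : x = q ^ 2 - 1 := by linarith
  rw [abs_le, hx']
  constructor
  · nlinarith [mul_nonneg (sub_nonneg.2 h1) (sub_nonneg.2 h1), mul_nonneg (sq_nonneg (q - 1)) (by nlinarith : 0 ≤ (q + 1) ^ 2 - 4)]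
  · nlinarith [sq_nonneg (q - 1), sq_nonneg (q ^ 2 - 1)]

/-- The area of the graph of the profile over a ball. -/
def graphArea (d : ℕ) (α r : ℝ) : ℝ :=
  ((μHE[d] : Measure (Euc (d + 1))) (graphOver (profile d α) (ball 0 r))).toReal

lemma graph_area_profile (hα : 0 < α) {R : ℝ} {A : Set (Euc d)} (hA : MeasurableSet A)
    (hAR : A ⊆ ball 0 R) :
    μHE[d] (graphOver (profile d α) A) =
      ∫⁻ s in A, ENNReal.ofReal √(1 + (‖s‖ ^ α) ^ 2) := by
  rw [graph_area isOpen_ball (lipschitzOnWith_profile hα R)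
    (Eventually.of_forall fun s _ => hasStrictFDerivAt_profile hα s) hA hAR]
  simp_rw [norm_profileDeriv hα]

lemma graph_profile_ball_ne_top (hα : 0 < α) (r : ℝ) :
    μHE[d] (graphOver (profile d α) (ball 0 r)) ≠ ∞ :=
  ((graph_area_le_of_lipschitz (lipschitzOnWith_profile hα r)).trans_lt
    (ENNReal.mul_lt_top (by simp) measure_ball_lt_top)).ne

/-- This graph is the rim where the top disc meets `∂Ω`, the only place where the trace of `capFun`
is not immediate. -/
lemma graph_profile_sphere (hα : 0 < α) (hd : 1 ≤ d) (r : ℝ) :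
    μHE[d] (graphOver (profile d α) (sphere 0 r)) = 0 := by
  have : NeZero d := ⟨by omega⟩
  rw [graph_area_profile hα (R := r + 1) isClosed_sphere.measurableSet
    (sphere_subset_closedBall.trans (closedBall_subset_ball (by linarith)))]
  exact setLIntegral_measure_zero _ _ (Measure.addHaar_sphere _ _ _)

lemma graphArea_eq (hα : 0 < α) (r : ℝ) :
    graphArea d α r = ∫ s in ball (0 : Euc d) r, √(1 + ‖s‖ ^ (2 * α)) := by
  rw [graphArea, graph_area_profile hα measurableSet_ball subset_rfl,
    integral_eq_lintegral_of_nonneg_ae (Eventually.of_forall fun s => Real.sqrt_nonneg _)]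
  · congr 2 with s
    rw [← Real.rpow_mul_natCast (norm_nonneg s), mul_comm α]
    norm_num
  · have : Continuous fun s : Euc d => √(1 + ‖s‖ ^ (2 * α)) :=
      (continuous_const.add (continuous_norm.rpow_const fun _ => Or.inr (by positivity))).sqrt
    exact this.aestronglyMeasurable

/-- Integrate the expansion of the square root at `x = |s|^(2α)` over the ball. The middle term
produces the limit of `J_-`, the right-hand side its error. -/
lemma abs_graphArea_sub_le (hα : 0 < α) (hd : 1 ≤ d) {r : ℝ} (hr : 0 ≤ r) :
    |graphArea d α r - omega d * r ^ (d : ℝ) -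
        d * omega d / (2 * (d + 2 * α)) * r ^ ((d : ℝ) + 2 * α)| ≤
      d * omega d / (8 * (d + 4 * α)) * r ^ ((d : ℝ) + 4 * α) := by
  have hi := integrableOn_ball_norm_rpow (d := d) (r := r) (β := 2 * α) (by positivity)
  have hi' := integrableOn_ball_norm_rpow (d := d) (r := r) (β := 4 * α) (by positivity)
  have h1 : IntegrableOn (fun _ : Euc d => (1 : ℝ)) (ball 0 r) :=
    integrableOn_const measure_ball_lt_top.ne
  have hs : IntegrableOn (fun s : Euc d => √(1 + ‖s‖ ^ (2 * α))) (ball 0 r) := by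
    have : Continuous fun s : Euc d => √(1 + ‖s‖ ^ (2 * α)) :=
      (continuous_const.add (continuous_norm.rpow_const fun _ => Or.inr (by positivity))).sqrt
    exact (this.continuousOn.integrableOn_compact (isCompact_closedBall 0 r)).mono_set
      ball_subset_closedBall
  have e1 : graphArea d α r - omega d * r ^ (d : ℝ) -
        d * omega d / (2 * (d + 2 * α)) * r ^ ((d : ℝ) + 2 * α) =
      ∫ s in ball (0 : Euc d) r, (√(1 + ‖s‖ ^ (2 * α)) - 1 - ‖s‖ ^ (2 * α) / 2) := by
    have hs1 : IntegrableOn (fun s : Euc d => √(1 + ‖s‖ ^ (2 * α)) - 1) (ball 0 r) := hs.sub h1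
    rw [integral_sub hs1 (hi.div_const 2), integral_sub hs h1, integral_div,
      integral_ball_norm_rpow hd (by positivity) hr, ← graphArea_eq hα, setIntegral_const,
      volume_real_ball hd hr, smul_eq_mul, mul_one]
    congr 1
    field_simp
  have e2 : d * omega d / (8 * (d + 4 * α)) * r ^ ((d : ℝ) + 4 * α) =
      ∫ s in ball (0 : Euc d) r, ‖s‖ ^ (4 * α) / 8 := by
    rw [integral_div, integral_ball_norm_rpow hd (by positivity) hr]
    field_simp
  rw [e1, e2]
  refine (abs_integral_le_integral_abs).trans
    (integral_mono_of_nonneg (Eventually.of_forall fun _ => abs_nonneg _) (hi'.div_const 8)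
      (Eventually.of_forall fun s => ?_))
  refine (abs_sqrt_one_add_sub_le (by positivity)).trans_eq ?_
  rw [← Real.rpow_mul_natCast (norm_nonneg s)]
  congr 2
  push_cast
  ring

lemma volume_real_cap (hα : 0 < α) (hd : 1 ≤ d) {r : ℝ} (hr : 0 ≤ r) :
    (volume : Measure (Euc (d + 1))).real (cap d α r) =
      omega d / (d + 1 + α) * r ^ ((d : ℝ) + 1 + α) := by
  have hi := integrableOn_ball_norm_rpow (d := d) (r := r) (β := 1 + α) (by positivity)
  have h1 : ∀ c : ℝ, IntegrableOn (fun _ : Euc d => c) (ball 0 r) := fun c =>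
    integrableOn_const measure_ball_lt_top.ne
  -- The base may be restricted to the ball because `ψ(|x'|) < x_N < ψ(r)` already forces `|x'| <
  -- r`.
  have e : cap d α r = split d ⁻¹'
      regionBetween (profile d α) (fun _ => psi α r) (ball 0 r) := by
    ext x
    simp only [cap, regionBetween, split_apply, mem_preimage, mem_ofPred_eq, mem_Ioo, profile,
      mem_ball_zero_iff]
    exact ⟨fun h => ⟨(psi_lt_psi_iff hα (norm_nonneg _) hr).1 (h.1.trans h.2), h⟩, fun h => h.2⟩
  have hp : IntegrableOn (profile d α) (ball 0 r) :=
    (hi.div_const (1 + α)).congr (Eventually.of_forall fun s => (profile_eq s).symm)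
  have hle : ∀ s ∈ ball (0 : Euc d) r, profile d α s ≤ psi α r := fun s hs =>
    (psi_lt_psi hα (norm_nonneg s) (by simpa using hs)).le
  rw [Measure.real, e, measurePreserving_split.measure_preimage_emb
    (split d).toHomeomorph.measurableEmbedding,
    volume_regionBetween_eq_integral hp (h1 _) measurableSet_ball hle, ENNReal.toReal_ofReal]
  · simp only [Pi.sub_apply]
    rw [integral_sub (h1 _) hp, setIntegral_const, volume_real_ball hd hr]
    simp_rw [profile_eq]
    rw [integral_div, integral_ball_norm_rpow hd (by positivity) hr, psi, abs_of_nonneg hr,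
      smul_eq_mul]
    have hd' : (0 : ℝ) < d := by exact_mod_cast hd
    have h2 : r ^ (d : ℝ) * r ^ (1 + α) = r ^ ((d : ℝ) + 1 + α) := by
      rw [add_assoc, Real.rpow_add_of_nonneg hr (y := (d : ℝ)) (z := 1 + α)
        (by positivity) (by positivity)]
    rw [← add_assoc, ← h2]
    generalize r ^ (d : ℝ) = u, r ^ (1 + α) = v
    field_simp
    ring
  · exact setIntegral_nonneg measurableSet_ball fun s hs => sub_nonneg.2 (hle s hs)

end

section

variable {d : ℕ} {α : ℝ}

/-! ### The divergence theorem on a half space -/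

lemma join_single_zero (j : Fin d) :
    join (EuclideanSpace.single j 1) 0 = (EuclideanSpace.single j.castSucc 1 : Euc (d + 1)) := by
  ext i
  refine Fin.lastCases ?_ (fun k => ?_) i
  · rw [join_apply_last]
    simp [(Fin.castSucc_ne_last j).symm]
  · rw [join_apply_castSucc]
    simp

lemma join_zero_one :
    join (0 : Euc d) 1 = (EuclideanSpace.single (Fin.last d) 1 : Euc (d + 1)) := by
  ext i
  refine Fin.lastCases ?_ (fun k => ?_) i
  · rw [join_apply_last]
    simp
  · rw [join_apply_castSucc]
    simp [Fin.castSucc_ne_last]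

lemma isClosedEmbedding_join_left (t : ℝ) : IsClosedEmbedding fun s : Euc d => join s t := by
  refine (Isometry.of_dist_eq fun s s' => ?_).isClosedEmbedding
  rw [dist_eq_norm, dist_eq_norm, join_sub_join, ← sq_eq_sq₀ (norm_nonneg _) (norm_nonneg _),
    norm_join_sq]
  simp

lemma isClosedEmbedding_join_right (s : Euc d) : IsClosedEmbedding fun t : ℝ => join s t := by
  refine (Isometry.of_dist_eq fun t t' => ?_).isClosedEmbedding
  rw [dist_eq_norm, dist_eq_norm, join_sub_join, ← sq_eq_sq₀ (norm_nonneg _) (norm_nonneg _),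
    norm_join_sq]
  simp

lemma hasFDerivAt_join_left (s : Euc d) (t : ℝ) :
    HasFDerivAt (fun s => join s t)
      (((split d).symm : Euc d × ℝ →L[ℝ] Euc (d + 1)).comp (.inl ℝ (Euc d) ℝ)) s :=
  ((split d).symm : Euc d × ℝ →L[ℝ] Euc (d + 1)).hasFDerivAt.comp s (hasFDerivAt_prodMk_left s t)

lemma hasDerivAt_join_right (s : Euc d) (t : ℝ) :
    HasDerivAt (fun t => join s t) (join 0 1) t := by
  have := ((split d).symm : Euc d × ℝ →L[ℝ] Euc (d + 1)).hasFDerivAt.comp t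
    (hasFDerivAt_prodMk_right s t)
  exact this.hasDerivAt

lemma contDiff_join {E : Type*} [NormedAddCommGroup E] [NormedSpace ℝ E] {f : E → Euc d}
    {g : E → ℝ} {n : WithTop ℕ∞} (hf : ContDiff ℝ n f) (hg : ContDiff ℝ n g) :
    ContDiff ℝ n fun x => join (f x) (g x) :=
  (split d).symm.contDiff.comp (hf.prodMk hg)

lemma measurableSet_vert_lt (h : ℝ) : MeasurableSet {x : Euc (d + 1) | vert x < h} :=
  measurableSet_lt measurable_vert measurable_const

lemma setIntegral_vert_lt {G : Euc (d + 1) → ℝ} (hG : Integrable G) (h : ℝ) :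
    ∫ x in {x | vert x < h}, G x = ∫ s : Euc d, ∫ t in Iio h, G (join s t) := by
  rw [← integral_indicator (measurableSet_vert_lt h), integral_join, integral_prod]
  · congr 1 with s
    rw [← integral_indicator measurableSet_Iio]
    congr 1 with t
    simp [indicator]
  · rw [integrable_join_iff]
    exact hG.indicator (measurableSet_vert_lt h)

lemma setIntegral_vert_lt_symm {G : Euc (d + 1) → ℝ} (hG : Integrable G) (h : ℝ) :
    ∫ x in {x | vert x < h}, G x = ∫ t in Iio h, ∫ s : Euc d, G (join s t) := by
  rw [← integral_indicator (measurableSet_vert_lt h), integral_join, integral_prod_symm,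
    ← integral_indicator measurableSet_Iio]
  · congr 1 with t
    by_cases ht : t < h <;> simp [indicator, ht]
  · rw [integrable_join_iff]
    exact hG.indicator (measurableSet_vert_lt h)

lemma integrable_fderiv_apply {n : ℕ} {g : Euc n → ℝ} (hg : ContDiff ℝ 1 g)
    (hc : HasCompactSupport g) (v : Euc n) : Integrable fun x => fderiv ℝ g x v :=
  ((hg.continuous_fderiv one_ne_zero).clm_apply continuous_const).integrable_of_hasCompactSupport
    (hc.fderiv_apply ℝ v)

/-- Integration by parts against the constant `1`. -/
lemma integral_fderiv_apply_eq_zero {n : ℕ} {g : Euc n → ℝ} (hg : ContDiff ℝ 1 g)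
    (hc : HasCompactSupport g) (v : Euc n) : ∫ x, fderiv ℝ g x v = 0 := by
  have := integral_mul_fderiv_eq_neg_fderiv_mul_of_integrable (μ := volume) (f := fun _ => (1 : ℝ))
    (g := g) (v := v) (by simp) (by simpa using integrable_fderiv_apply hg hc v)
    (by simpa using hg.continuous.integrable_of_hasCompactSupport hc)
    (fun _ _ => differentiableAt_const _) (fun x _ => hg.differentiable one_ne_zero x)
  simpa using this

/-- Horizontal slices lie entirely inside or outside the half space, so each contributes the
integral of a compactly supported derivative. -/
lemma setIntegral_vert_lt_fderiv_horizontal {g : Euc (d + 1) → ℝ} (hg : ContDiff ℝ 1 g)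
    (hc : HasCompactSupport g) (h : ℝ) (v : Euc d) :
    ∫ x in {x | vert x < h}, fderiv ℝ g x (join v 0) = 0 := by
  rw [setIntegral_vert_lt_symm (integrable_fderiv_apply hg hc _)]
  have : ∀ t : ℝ, ∫ s : Euc d, fderiv ℝ g (join s t) (join v 0) = 0 := fun t => by
    have h1 := integral_fderiv_apply_eq_zero (g := fun s : Euc d => g (join s t))
      (hg.comp (contDiff_join contDiff_id contDiff_const))
      (hc.comp_isClosedEmbedding (isClosedEmbedding_join_left t)) v
    refine (integral_congr_ae (Eventually.of_forall fun s => ?_)).trans h1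
    exact (congrArg (fun L : Euc d →L[ℝ] ℝ => L v)
      ((hg.differentiable one_ne_zero _).hasFDerivAt.comp s
        (hasFDerivAt_join_left s t)).fderiv).symm
  simp [this]

/-- The fundamental theorem of calculus on each vertical half line leaves the value at height `h`.
-/
lemma setIntegral_vert_lt_fderiv_vertical {g : Euc (d + 1) → ℝ} (hg : ContDiff ℝ 1 g)
    (hc : HasCompactSupport g) (h : ℝ) :
    ∫ x in {x | vert x < h}, fderiv ℝ g x (join 0 1) = ∫ s : Euc d, g (join s h) := by
  rw [setIntegral_vert_lt (integrable_fderiv_apply hg hc _)]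
  congr 1 with s
  have h1 := HasCompactSupport.integral_Iic_deriv_eq (f := fun t : ℝ => g (join s t))
      (hg.comp (contDiff_join contDiff_const contDiff_id))
      (hc.comp_isClosedEmbedding (isClosedEmbedding_join_right s)) h
  rw [← h1, integral_Iic_eq_integral_Iio]
  congr 1 with t
  exact ((hg.differentiable one_ne_zero _).hasFDerivAt.comp_hasDerivAt t
    (hasDerivAt_join_right s t)).deriv.symm

lemma fderiv_coord {n m : ℕ} {φ : Euc m → Euc n} (hφ : ContDiff ℝ 1 φ) (x v : Euc m) (i : Fin n) :
    (fderiv ℝ φ x v) i = fderiv ℝ (fun y => φ y i) x v := by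
  have := (EuclideanSpace.proj (𝕜 := ℝ) i : Euc n →L[ℝ] ℝ).hasFDerivAt.comp x
    (hφ.differentiable one_ne_zero x).hasFDerivAt
  exact (congrArg (fun L : Euc m →L[ℝ] ℝ => L v) this.fderiv).symm

/-- The divergence theorem on the half space `{x_N < h}`. -/
lemma setIntegral_vert_lt_divergence {φ : Euc (d + 1) → Euc (d + 1)} (hφ : ContDiff ℝ 1 φ)
    (hc : HasCompactSupport φ) (h : ℝ) :
    ∫ x in {x | vert x < h}, divergence φ x = ∫ s : Euc d, vert (φ (join s h)) := by
  have hφi : ∀ i, ContDiff ℝ 1 fun x => φ x i := fun i =>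
    (EuclideanSpace.proj (𝕜 := ℝ) i : Euc (d + 1) →L[ℝ] ℝ).contDiff.comp hφ
  have hci : ∀ i, HasCompactSupport fun x => φ x i := fun i =>
    hc.comp_left (g := fun v : Euc (d + 1) => v i) rfl
  simp_rw [divergence, fderiv_coord hφ]
  rw [integral_finsetSum _ fun i _ => (integrable_fderiv_apply (hφi i) (hci i) _).integrableOn,
    Fin.sum_univ_castSucc]
  simp_rw [← join_single_zero, ← join_zero_one]
  rw [setIntegral_vert_lt_fderiv_vertical (hφi _) (hci _)]
  simp_rw [setIntegral_vert_lt_fderiv_horizontal (hφi _) (hci _)]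
  simp [vert]

/-! ### The total variation of the functions of the sequence -/

section model

variable {η : ℝ} {Ω : Set (Euc (d + 1))}

lemma IsModelDomain.mem_iff (hΩ : IsModelDomain α η Ω) {x : Euc (d + 1)} (hx : vert x < η) :
    x ∈ Ω ↔ psi α ‖hor x‖ < vert x := by
  have := Set.ext_iff.1 hΩ.eq x
  simpa [hx] using this

lemma IsModelDomain.inter_eq_cap (hΩ : IsModelDomain α η Ω) {r : ℝ} (hr : psi α r ≤ η) :
    Ω ∩ {x | vert x < psi α r} = cap d α r := by
  ext x
  exact ⟨fun h => ⟨(hΩ.mem_iff (lt_of_lt_of_le h.2 hr)).1 h.1, h.2⟩,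
    fun h => ⟨(hΩ.mem_iff (lt_of_lt_of_le h.2 hr)).2 h.1, h.2⟩⟩

lemma IsModelDomain.cap_subset (hΩ : IsModelDomain α η Ω) {r : ℝ} (hr : psi α r ≤ η) :
    cap d α r ⊆ Ω :=
  hΩ.inter_eq_cap hr ▸ inter_subset_left

lemma measurableSet_cap (hα : 0 < α) (r : ℝ) : MeasurableSet (cap d α r) :=
  (measurableSet_lt (((continuous_psi hα).comp (continuous_norm.comp continuous_hor)).measurable)
    measurable_vert).inter (measurableSet_vert_lt _)

lemma divergence_eq_zero {n : ℕ} {φ : Euc n → Euc n} {x : Euc n} (hx : x ∉ tsupport φ) :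
    divergence φ x = 0 := by
  have : fderiv ℝ φ x = 0 := by
    by_contra h
    exact hx (support_fderiv_subset ℝ h)
  simp [divergence, this]

/-- A test field vanishes off `Ω`, so integrating its divergence over the cap is the same as over
the whole half space. The curved bottom therefore contributes nothing. -/
lemma IsModelDomain.integral_capFun_mul_divergence (hΩ : IsModelDomain α η Ω)
    {r : ℝ} (hr : psi α r ≤ η) {φ : Euc (d + 1) → Euc (d + 1)} (hφ : φ ∈ testFields Ω) :
    ∫ x in Ω, capFun d α r x * divergence φ x =
      (r ^ ((d : ℝ) + 2 * α))⁻¹ * ∫ s : Euc d, vert (φ (join s (psi α r))) := by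
  rw [← setIntegral_vert_lt_divergence hφ.1 hφ.2.1, ← integral_const_mul,
    ← integral_indicator hΩ.isC1.isOpen.measurableSet,
    ← integral_indicator (measurableSet_vert_lt _)]
  congr 1 with x
  by_cases h1 : x ∈ Ω
  · by_cases h2 : vert x < psi α r
    · have : x ∈ cap d α r := hΩ.inter_eq_cap hr ▸ ⟨h1, h2⟩
      simp [indicator, capFun, h1, h2, this]
    · have : x ∉ cap d α r := fun h => h2 h.2
      simp [indicator, capFun, h2, this]
  · have : x ∉ tsupport φ := fun h => h1 (hφ.2.2.1 h)
    simp [indicator, h1, divergence_eq_zero this]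

/-- The closed disc of radius `ρ < r` at height `ψ(r)` is compact in `Ω`, so the vertical unit field
can be cut off around it. For `ρ = r` the rim would touch `∂Ω`. -/
lemma exists_testField (hα : 0 < α) (hΩ : IsModelDomain α η Ω) {ρ r : ℝ} (hr : psi α r < η)
    (hρr : ρ < r) :
    ∃ φ ∈ testFields Ω, (∀ x, 0 ≤ vert (φ x)) ∧
      ∀ s : Euc d, ‖s‖ ≤ ρ → vert (φ (join s (psi α r))) = 1 := by
  set K : Set (Euc (d + 1)) := (fun s => join s (psi α r)) '' closedBall 0 ρ with hK
  have hKc : IsCompact K :=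
    (isCompact_closedBall 0 ρ).image (continuous_join continuous_id continuous_const)
  have hKΩ : K ⊆ Ω := by
    rintro _ ⟨s, hs, rfl⟩
    rw [hΩ.mem_iff (by simpa using hr)]
    have : ‖s‖ ≤ ρ := by simpa using hs
    simpa using psi_lt_psi hα (norm_nonneg s) (this.trans_lt hρr)
  obtain ⟨L, hL, hKL, hLΩ⟩ := exists_compact_between hKc hΩ.isC1.isOpen hKΩ
  obtain ⟨θ, hθ, hθr, hθ0, hθ1⟩ := exists_contMDiff_zero_iff_one_iff_of_isClosed
    (modelWithCornersSelf ℝ (Euc (d + 1))) (n := 1)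
    (isOpen_interior (s := L)).isClosed_compl hKc.isClosed
    (disjoint_left.2 fun x hx hx' => hx (hKL hx'))
  have hsupp : Function.support θ ⊆ L := fun x hx => by
    by_contra h
    exact hx ((hθ0 x).1 fun h' => h (interior_subset h'))
  have ht : tsupport θ ⊆ L := closure_minimal hsupp hL.isClosed
  have hsub : tsupport (fun x => θ x • (join 0 1 : Euc (d + 1))) ⊆ tsupport θ :=
    closure_mono fun x hx h => hx (by simp [h])
  have h1 : ‖(join 0 1 : Euc (d + 1))‖ = 1 := by rw [join_zero_one]; simp
  have hv : ∀ x, vert (θ x • (join 0 1 : Euc (d + 1))) = θ x := fun x => by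
    rw [← vertL_apply, map_smul, vertL_apply, vert_join, smul_eq_mul, mul_one]
  refine ⟨fun x => θ x • join 0 1, ⟨hθ.contDiff.smul contDiff_const,
    hL.of_isClosed_subset (isClosed_tsupport _) (hsub.trans ht), hsub.trans (ht.trans hLΩ),
    fun x => ?_⟩, fun x => ?_, fun s hs => ?_⟩
  · have := hθr (mem_range_self x)
    rw [norm_smul, h1, mul_one, Real.norm_eq_abs, abs_of_nonneg this.1]
    exact this.2
  · rw [hv]
    exact (hθr (mem_range_self x)).1
  · rw [hv, ← hθ1]
    exact ⟨s, by simpa using hs, rfl⟩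

lemma IsModelDomain.totalVariation_capFun (hd : 1 ≤ d) (hα : 0 < α) (hΩ : IsModelDomain α η Ω)
    {r : ℝ} (hr0 : 0 < r) (hr : psi α r < η) :
    totalVariation Ω (capFun d α r) =
      ENNReal.ofReal ((r ^ ((d : ℝ) + 2 * α))⁻¹ * (omega d * r ^ (d : ℝ))) := by
  have hc : 0 ≤ (r ^ ((d : ℝ) + 2 * α))⁻¹ := by positivity
  have hint : ∀ φ ∈ testFields Ω, Integrable fun s : Euc d => vert (φ (join s (psi α r))) := by
    intro φ hφ
    refine Continuous.integrable_of_hasCompactSupport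
      (continuous_vert.comp (hφ.1.continuous.comp
        (continuous_join continuous_id continuous_const))) ?_
    exact (hφ.2.1.comp_isClosedEmbedding (isClosedEmbedding_join_left _)).comp_left
      (g := vert) vert_zero
  apply le_antisymm
  -- Upper bound: the flux density is at most `1`, and it vanishes off the open disc because there
  -- the point at height `ψ(r)` is outside `Ω`.
  · refine iSup₂_le fun φ hφ => ENNReal.ofReal_le_ofReal ?_
    rw [hΩ.integral_capFun_mul_divergence hr.le hφ]
    gcongr
    rw [← volume_real_ball hd hr0.le, ← integral_indicator_one measurableSet_ball]
    refine integral_mono (hint φ hφ)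
      ((integrable_indicator_iff measurableSet_ball).2
        (integrableOn_const measure_ball_lt_top.ne)) fun s => ?_
    by_cases hs : s ∈ ball 0 r
    · simp only [indicator, hs, if_true, Pi.one_apply]
      exact (le_abs_self _).trans ((abs_vert_le _).trans (hφ.2.2.2 _))
    · have : φ (join s (psi α r)) = 0 := by
        refine image_eq_zero_of_notMem_tsupport fun h => ?_
        have := (hΩ.mem_iff (by simpa using hr)).1 (hφ.2.2.1 h)
        rw [hor_join, vert_join, psi_lt_psi_iff hα (norm_nonneg _) hr0.le] at this
        exact hs (by simpa using this)
      simp [this, hs]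
  -- Lower bound: cutoffs reach the area of each smaller disc; then `ρ` increases to `r`.
  · have hev : ∀ᶠ ρ in 𝓝[<] r, ENNReal.ofReal ((r ^ ((d : ℝ) + 2 * α))⁻¹ *
        (omega d * ρ ^ (d : ℝ))) ≤ totalVariation Ω (capFun d α r) := by
      filter_upwards [Ioo_mem_nhdsLT hr0] with ρ hρ
      obtain ⟨φ, hφ, hφ0, hφ1⟩ := exists_testField hα hΩ hr hρ.2
      refine le_trans (ENNReal.ofReal_le_ofReal ?_) (le_iSup₂ (f := fun φ _ =>
        ENNReal.ofReal (∫ x in Ω, capFun d α r x * divergence φ x)) φ hφ)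
      rw [hΩ.integral_capFun_mul_divergence hr.le hφ]
      gcongr
      rw [← volume_real_ball hd hρ.1.le, ← integral_indicator_one measurableSet_ball]
      refine integral_mono ((integrable_indicator_iff measurableSet_ball).2
        (integrableOn_const measure_ball_lt_top.ne)) (hint φ hφ) fun s => ?_
      by_cases hs : s ∈ ball 0 ρ
      · have := hφ1 s (by simpa using (mem_ball_zero_iff.1 hs).le)
        simp [this, hs]
      · simp [hs, hφ0]
    refine le_of_tendsto ?_ hev
    refine ENNReal.tendsto_ofReal (tendsto_const_nhds.mul (tendsto_const_nhds.mul ?_))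
    exact ((Real.continuousAt_rpow_const r d (Or.inl hr0.ne')).tendsto).mono_left
      nhdsWithin_le_nhds

end model

end

section

variable {d : ℕ} {α : ℝ}

/-! ### Boundary traces -/

section trace

variable {n : ℕ} {Ω : Set (Euc n)} {u v : Euc n → ℝ} {x : Euc n} {a b : ℝ}

lemma hasTraceAt_of_eqOn {ρ₀ : ℝ} (hΩ : MeasurableSet Ω) (hρ₀ : 0 < ρ₀)
    (h : ∀ y ∈ ball x ρ₀ ∩ Ω, u y = a) : HasTraceAt Ω u x a := by
  refine tendsto_const_nhds.congr' ?_
  filter_upwards [Ioo_mem_nhdsGT hρ₀] with ρ hρ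
  rw [setAverage_eq, setIntegral_congr_fun (g := fun _ => 0) (measurableSet_ball.inter hΩ)]
  · simp
  · intro y hy
    simp [h y ⟨ball_subset_ball hρ.2.le hy.1, hy.2⟩]

/-- Average `|a - b| ≤ |u - a| + |u - b|` over `B(x, ρ) ∩ Ω`. This set has positive measure since
`Ω` is open and `x` lies in its closure. -/
lemma HasTraceAt.unique (hΩ : IsOpen Ω) (hu : IntegrableOn u Ω) (hx : x ∈ frontier Ω)
    (ha : HasTraceAt Ω u x a) (hb : HasTraceAt Ω u x b) : a = b := by
  have h0 : Tendsto (fun _ : ℝ => |a - b|) (𝓝[>] 0) (𝓝 0) := by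
    refine squeeze_zero' (Eventually.of_forall fun _ => abs_nonneg _) ?_
      (by simpa using ha.add hb)
    filter_upwards [self_mem_nhdsWithin] with ρ hρ
    have hne : (ball x ρ ∩ Ω).Nonempty :=
      mem_closure_iff_nhds.1 (frontier_subset_closure hx) _ (ball_mem_nhds x hρ)
    have hpos : 0 < volume (ball x ρ ∩ Ω) := (isOpen_ball.inter hΩ).measure_pos _ hne
    have hfin : volume (ball x ρ ∩ Ω) ≠ ∞ :=
      ((measure_mono inter_subset_left).trans_lt measure_ball_lt_top).ne
    have hui : IntegrableOn u (ball x ρ ∩ Ω) := hu.mono_set inter_subset_right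
    have hi : ∀ c : ℝ, IntegrableOn (fun y => |u y - c|) (ball x ρ ∩ Ω) := fun c =>
      (hui.sub (integrableOn_const hfin)).abs
    have hm : 0 < volume.real (ball x ρ ∩ Ω) := ENNReal.toReal_pos hpos.ne' hfin
    rw [setAverage_eq, setAverage_eq, ← smul_add, ← integral_add (hi a) (hi b), smul_eq_mul,
      ← div_eq_inv_mul, le_div_iff₀ hm, mul_comm, ← smul_eq_mul, ← setIntegral_const]
    refine integral_mono (integrableOn_const hfin) ((hi a).add (hi b)) fun y => ?_
    calc |a - b| ≤ |a - u y| + |u y - b| := abs_sub_le _ _ _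
      _ = |u y - a| + |u y - b| := by rw [abs_sub_comm]
  have := tendsto_nhds_unique tendsto_const_nhds h0
  exact sub_eq_zero.1 (abs_eq_zero.1 this)

lemma HasTraceAt.trace_eq (hΩ : IsOpen Ω) (hu : IntegrableOn u Ω) (hx : x ∈ frontier Ω)
    (ha : HasTraceAt Ω u x a) : trace Ω u x = a := by
  have h : ∃ a, HasTraceAt Ω u x a := ⟨a, ha⟩
  rw [trace, dif_pos h]
  exact h.choose_spec.unique hΩ hu hx ha

lemma hasTraceAt_congr (h : u =ᵐ[volume.restrict Ω] v) :
    HasTraceAt Ω u = HasTraceAt Ω v := by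
  funext x a
  have : ∀ ρ : ℝ, ⨍ y in ball x ρ ∩ Ω, |u y - a| = ⨍ y in ball x ρ ∩ Ω, |v y - a| := fun ρ => by
    refine average_congr ?_
    filter_upwards [ae_restrict_of_ae_restrict_of_subset inter_subset_right h] with y hy
    rw [hy]
  simp [HasTraceAt, this]

lemma trace_congr (h : u =ᵐ[volume.restrict Ω] v) : trace Ω u = trace Ω v := by
  funext x
  -- Both traces are the same function `F` of the predicate of trace values, which avoids rewriting
  -- inside the dependent `if`.
  let F : (ℝ → Prop) → ℝ := fun P =>
    letI := Classical.propDecidable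
    if h : ∃ a, P a then h.choose else 0
  exact congrArg F (congrFun (hasTraceAt_congr h) x)

lemma totalVariation_congr (h : u =ᵐ[volume.restrict Ω] v) :
    totalVariation Ω u = totalVariation Ω v := by
  have : ∀ φ : Euc n → Euc n,
      ∫ x in Ω, u x * divergence φ x = ∫ x in Ω, v x * divergence φ x := fun φ => by
    refine integral_congr_ae ?_
    filter_upwards [h] with y hy
    rw [hy]
  simp [totalVariation, this]

lemma memBV_congr (h : u =ᵐ[volume.restrict Ω] v) : MemBV Ω u ↔ MemBV Ω v := by
  rw [MemBV, MemBV, totalVariation_congr h, IntegrableOn, integrable_congr h, IntegrableOn]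

end trace

/-! ### The boundary of a model domain and the traces of the sequence -/

section model

variable {η : ℝ} {Ω : Set (Euc (d + 1))}

lemma continuous_psi_norm_hor (hα : 0 < α) :
    Continuous fun x : Euc (d + 1) => psi α ‖hor x‖ :=
  (continuous_psi hα).comp (continuous_norm.comp continuous_hor)

lemma IsModelDomain.mem_frontier_iff (hα : 0 < α) (hΩ : IsModelDomain α η Ω) {x : Euc (d + 1)}
    (hx : vert x < η) : x ∈ frontier Ω ↔ vert x = profile d α (hor x) := by
  rw [hΩ.isC1.isOpen.frontier_eq, Set.mem_sdiff, hΩ.mem_iff hx, not_lt]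
  constructor
  · rintro ⟨h1, h2⟩
    refine le_antisymm h2 ?_
    have h3 : x ∈ closure (Ω ∩ {x | vert x < η}) :=
      (isOpen_lt continuous_vert continuous_const).closure_inter ⟨h1, hx⟩
    have h4 : Ω ∩ {x | vert x < η} ⊆ {x | psi α ‖hor x‖ ≤ vert x} := fun y hy =>
      ((hΩ.mem_iff hy.2).1 hy.1).le
    exact closure_minimal h4 (isClosed_le (continuous_psi_norm_hor hα) continuous_vert) h3
  · intro h
    refine ⟨?_, h.le⟩
    -- Points vertically above a graph point lie in `Ω` and converge to it.
    have h1 : Tendsto (fun t => join (hor x) t) (𝓝[>] (vert x)) (𝓝 x) := by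
      have : Continuous fun t => join (hor x) t := continuous_join continuous_const continuous_id
      have := (this.tendsto (vert x)).mono_left (nhdsWithin_le_nhds (s := Ioi (vert x)))
      rwa [join_hor_vert] at this
    refine mem_closure_of_tendsto h1 ?_
    filter_upwards [Ioo_mem_nhdsGT hx] with t ht
    rw [hΩ.mem_iff (by simpa using ht.2), hor_join, vert_join]
    exact lt_of_eq_of_lt h.symm ht.1

lemma IsModelDomain.frontier_inter_vert_lt (hα : 0 < α) (hΩ : IsModelDomain α η Ω) {r : ℝ}
    (hr0 : 0 ≤ r) (hr : psi α r ≤ η) :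
    frontier Ω ∩ {x | vert x < psi α r} = graphOver (profile d α) (ball 0 r) := by
  ext x
  simp only [mem_inter_iff, mem_ofPred_eq, graphOver, mem_ball_zero_iff]
  rw [← psi_lt_psi_iff hα (norm_nonneg _) hr0]
  constructor
  · rintro ⟨h1, h2⟩
    have := (hΩ.mem_frontier_iff hα (h2.trans_le hr)).1 h1
    exact ⟨by rwa [this] at h2, this⟩
  · rintro ⟨h1, h2⟩
    have h3 : vert x < psi α r := h2 ▸ h1
    exact ⟨(hΩ.mem_frontier_iff hα (h3.trans_le hr)).2 h2, h3⟩

lemma IsModelDomain.frontier_inter_vert_eq_subset (hα : 0 < α) (hΩ : IsModelDomain α η Ω) {r : ℝ}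
    (hr0 : 0 ≤ r) (hr : psi α r < η) :
    frontier Ω ∩ {x | vert x = psi α r} ⊆ graphOver (profile d α) (sphere 0 r) := by
  rintro x ⟨h1, h2 : vert x = psi α r⟩
  have h3 := (hΩ.mem_frontier_iff hα (h2 ▸ hr)).1 h1
  refine ⟨?_, h3⟩
  have h4 : psi α ‖hor x‖ = psi α r := h3.symm.trans h2
  rw [mem_sphere_zero_iff_norm]
  rcases lt_trichotomy ‖hor x‖ r with h | h | h
  · exact absurd h4 (psi_lt_psi hα (norm_nonneg _) h).ne
  · exact h
  · exact absurd h4 (psi_lt_psi hα hr0 h).ne'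

lemma IsModelDomain.ae_vert_ne (hα : 0 < α) (hd : 1 ≤ d) (hΩ : IsModelDomain α η Ω) {r : ℝ}
    (hr0 : 0 ≤ r) (hr : psi α r < η) :
    ∀ᵐ x ∂(surfaceMeasure Ω), x ∈ frontier Ω ∧ vert x ≠ psi α r := by
  have hm : MeasurableSet (frontier Ω) := isClosed_frontier.measurableSet
  rw [surfaceMeasure]
  refine (ae_restrict_mem hm).and ?_
  rw [ae_restrict_iff' hm, ae_iff]
  refine measure_mono_null (fun x hx => ?_) (graph_profile_sphere hα hd r)
  simp only [ne_eq, Classical.not_imp, not_not, mem_ofPred_eq] at hx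
  exact hΩ.frontier_inter_vert_eq_subset hα hr0 hr hx

lemma IsModelDomain.capFun_eq (hΩ : IsModelDomain α η Ω) {r : ℝ} (hr : psi α r ≤ η)
    {x : Euc (d + 1)} (hx : x ∈ Ω) :
    capFun d α r x =
      {x : Euc (d + 1) | vert x < psi α r}.indicator (fun _ => (r ^ ((d : ℝ) + 2 * α))⁻¹) x := by
  have : x ∈ cap d α r ↔ vert x < psi α r := by
    rw [← hΩ.inter_eq_cap hr]
    simp [hx]
  by_cases h : vert x < psi α r <;> simp [capFun, indicator, this, h]

/-- Off the height `ψ(r)` the function is constant on `Ω` near `x`, with the value of the side on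
which `x` lies. -/
lemma IsModelDomain.hasTraceAt_capFun (hΩ : IsModelDomain α η Ω) {r : ℝ} (hr : psi α r ≤ η)
    {x : Euc (d + 1)} (hx : vert x ≠ psi α r) :
    HasTraceAt Ω (capFun d α r) x
      ({x : Euc (d + 1) | vert x < psi α r}.indicator
        (fun _ => (r ^ ((d : ℝ) + 2 * α))⁻¹) x) := by
  have hm := hΩ.isC1.isOpen.measurableSet
  rcases lt_or_gt_of_ne hx with h | h
  · obtain ⟨ρ, hρ, hs⟩ := Metric.isOpen_iff.1 (isOpen_lt continuous_vert continuous_const) x h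
    refine hasTraceAt_of_eqOn hm hρ fun y hy => ?_
    have h1 : vert y < psi α r := hs hy.1
    rw [hΩ.capFun_eq hr hy.2, indicator_of_mem, indicator_of_mem]
    · exact h
    · exact h1
  · obtain ⟨ρ, hρ, hs⟩ := Metric.isOpen_iff.1 (isOpen_lt continuous_const continuous_vert) x h
    refine hasTraceAt_of_eqOn hm hρ fun y hy => ?_
    have h1 : psi α r < vert y := hs hy.1
    rw [hΩ.capFun_eq hr hy.2, indicator_of_notMem, indicator_of_notMem]
    · exact fun h' => lt_asymm h h'
    · exact fun h' => lt_asymm h1 h'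

lemma omega_pos (d : ℕ) : 0 < omega d :=
  ENNReal.toReal_pos (measure_ball_pos _ _ one_pos).ne' measure_ball_lt_top.ne

lemma integrable_capFun (hα : 0 < α) (hd : 1 ≤ d) {r : ℝ} (hr0 : 0 < r) :
    Integrable (capFun d α r) := by
  rw [capFun, integrable_indicator_iff (measurableSet_cap hα r)]
  -- If the volume were infinite its real value would be `0`, against the positive formula of
  -- `volume_real_cap`.
  refine integrableOn_const fun h => ?_
  have h1 := volume_real_cap (d := d) hα hd hr0.le
  rw [Measure.real, h, ENNReal.toReal_top] at h1
  have := omega_pos d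
  have : 0 < omega d / (d + 1 + α) * r ^ ((d : ℝ) + 1 + α) := by positivity
  exact this.ne h1

lemma IsModelDomain.memBV_capFun (hα : 0 < α) (hd : 1 ≤ d) (hΩ : IsModelDomain α η Ω) {r : ℝ}
    (hr0 : 0 < r) (hr : psi α r < η) : MemBV Ω (capFun d α r) :=
  ⟨(integrable_capFun hα hd hr0).integrableOn, by
    rw [hΩ.totalVariation_capFun hd hα hr0 hr]
    exact ENNReal.ofReal_ne_top⟩

lemma IsModelDomain.trace_capFun_ae (hα : 0 < α) (hd : 1 ≤ d) (hΩ : IsModelDomain α η Ω) {r : ℝ}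
    (hr0 : 0 < r) (hr : psi α r < η) :
    trace Ω (capFun d α r) =ᵐ[surfaceMeasure Ω]
      {x : Euc (d + 1) | vert x < psi α r}.indicator (fun _ => (r ^ ((d : ℝ) + 2 * α))⁻¹) := by
  filter_upwards [hΩ.ae_vert_ne hα hd hr0.le hr] with x hx
  exact (hΩ.hasTraceAt_capFun hr.le hx.2).trace_eq hΩ.isC1.isOpen
    (integrable_capFun hα hd hr0).integrableOn hx.1

lemma IsModelDomain.surfaceMeasure_vert_lt (hα : 0 < α) (hΩ : IsModelDomain α η Ω) {r : ℝ}
    (hr0 : 0 ≤ r) (hr : psi α r ≤ η) :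
    surfaceMeasure Ω {x | vert x < psi α r} =
      μHE[d] (graphOver (profile d α) (ball 0 r)) := by
  rw [surfaceMeasure, Measure.restrict_apply (measurableSet_vert_lt _), inter_comm,
    hΩ.frontier_inter_vert_lt hα hr0 hr]

lemma IsModelDomain.integrable_trace_capFun (hα : 0 < α) (hd : 1 ≤ d) (hΩ : IsModelDomain α η Ω)
    {r : ℝ} (hr0 : 0 < r) (hr : psi α r < η) :
    Integrable (trace Ω (capFun d α r)) (surfaceMeasure Ω) := by
  rw [integrable_congr (hΩ.trace_capFun_ae hα hd hr0 hr),
    integrable_indicator_iff (measurableSet_vert_lt _)]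
  refine integrableOn_const ?_
  rw [hΩ.surfaceMeasure_vert_lt hα hr0.le hr.le]
  exact graph_profile_ball_ne_top hα r

lemma IsModelDomain.integral_abs_trace_capFun (hα : 0 < α) (hd : 1 ≤ d)
    (hΩ : IsModelDomain α η Ω) {r : ℝ} (hr0 : 0 < r) (hr : psi α r < η) :
    ∫ x, |trace Ω (capFun d α r) x| ∂(surfaceMeasure Ω) =
      (r ^ ((d : ℝ) + 2 * α))⁻¹ * graphArea d α r := by
  have : (fun x => |trace Ω (capFun d α r) x|) =ᵐ[surfaceMeasure Ω]
      {x : Euc (d + 1) | vert x < psi α r}.indicator (fun _ => (r ^ ((d : ℝ) + 2 * α))⁻¹) := by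
    filter_upwards [hΩ.trace_capFun_ae hα hd hr0 hr] with x hx
    rw [hx, abs_of_nonneg]
    exact indicator_nonneg (fun _ _ => by positivity) x
  rw [integral_congr_ae this, integral_indicator (measurableSet_vert_lt _), setIntegral_const,
    Measure.real, hΩ.surfaceMeasure_vert_lt hα hr0.le hr.le, smul_eq_mul, mul_comm, graphArea]

/-! ### The values of `J_-` along the sequence -/

lemma IsModelDomain.Jminus_capFun (hα : 0 < α) (hd : 1 ≤ d) (hΩ : IsModelDomain α η Ω) {r : ℝ}
    (hr0 : 0 < r) (hr : psi α r < η) :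
    Jminus Ω (capFun d α r) =
      (r ^ ((d : ℝ) + 2 * α))⁻¹ * (omega d * r ^ (d : ℝ) - graphArea d α r) := by
  have := omega_pos d
  rw [Jminus, hΩ.totalVariation_capFun hd hα hr0 hr, hΩ.integral_abs_trace_capFun hα hd hr0 hr,
    ENNReal.toReal_ofReal (by positivity), mul_sub]

lemma IsModelDomain.abs_Jminus_capFun_sub_le (hα : 0 < α) (hd : 1 ≤ d)
    (hΩ : IsModelDomain α η Ω) {r : ℝ} (hr0 : 0 < r) (hr : psi α r < η) :
    |Jminus Ω (capFun d α r) - (-((d : ℝ) * omega d / (2 * ((d : ℝ) + 2 * α))))| ≤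
      d * omega d / (8 * (d + 4 * α)) * r ^ (2 * α) := by
  have h1 : 0 < r ^ ((d : ℝ) + 2 * α) := by positivity
  have h2 : r ^ ((d : ℝ) + 4 * α) = r ^ ((d : ℝ) + 2 * α) * r ^ (2 * α) := by
    rw [← Real.rpow_add hr0]
    congr 1
    ring
  have h3 := abs_graphArea_sub_le (d := d) hα hd hr0.le
  rw [h2] at h3
  rw [hΩ.Jminus_capFun hα hd hr0 hr]
  set q := r ^ ((d : ℝ) + 2 * α)
  have h4 : q⁻¹ * (omega d * r ^ (d : ℝ) - graphArea d α r) -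
      (-((d : ℝ) * omega d / (2 * ((d : ℝ) + 2 * α)))) =
      -(q⁻¹ * (graphArea d α r - omega d * r ^ (d : ℝ) -
        d * omega d / (2 * (d + 2 * α)) * q)) := by
    linear_combination (-((d : ℝ) * omega d / (2 * ((d : ℝ) + 2 * α)))) *
      (inv_mul_cancel₀ h1.ne')
  rw [h4, abs_neg, abs_mul, abs_of_nonneg (by positivity : 0 ≤ q⁻¹)]
  calc _ ≤ q⁻¹ * (d * omega d / (8 * (d + 4 * α)) * (q * r ^ (2 * α))) := by gcongr
    _ = (q⁻¹ * q) * (d * omega d / (8 * (d + 4 * α)) * r ^ (2 * α)) := by ring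
    _ = _ := by rw [inv_mul_cancel₀ h1.ne', one_mul]

lemma IsModelDomain.integral_abs_capFun (hα : 0 < α) (hd : 1 ≤ d) (hΩ : IsModelDomain α η Ω)
    {r : ℝ} (hr0 : 0 < r) (hr : psi α r ≤ η) :
    ∫ x in Ω, |capFun d α r x| = omega d / ((d : ℝ) + 1 + α) * r ^ (1 - α) := by
  have h1 : ∀ x, |capFun d α r x| = capFun d α r x := fun x =>
    abs_of_nonneg (indicator_nonneg (fun _ _ => by positivity) x)
  have h2 : 0 < r ^ ((d : ℝ) + 2 * α) := by positivity
  simp_rw [h1, capFun]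
  rw [setIntegral_indicator (measurableSet_cap hα r),
    inter_eq_self_of_subset_right (hΩ.cap_subset hr), setIntegral_const, volume_real_cap hα hd hr0.le,
    -- Volume exponent minus normalizing exponent: only `r^(1-α)` survives.
    smul_eq_mul, show (d : ℝ) + 1 + α = (1 - α) + (d + 2 * α) by ring, Real.rpow_add hr0,
    mul_assoc, mul_assoc, mul_inv_cancel₀ h2.ne', mul_one]

end model

end

section

variable {d : ℕ} {α η : ℝ} {Ω : Set (Euc (d + 1))}

/-! ### Failure of lower semicontinuity -/

lemma Jminus_congr {u v : Euc (d + 1) → ℝ} (h : u =ᵐ[volume.restrict Ω] v) :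
    Jminus Ω u = Jminus Ω v := by
  rw [Jminus, Jminus, totalVariation_congr h, trace_congr h]

lemma Jminus_zero (hΩ : IsOpen Ω) : Jminus Ω 0 = 0 := by
  have h1 : totalVariation Ω (0 : Euc (d + 1) → ℝ) = 0 := by simp [totalVariation]
  have h2 : ∫ x, |trace Ω 0 x| ∂(surfaceMeasure Ω) = 0 := by
    rw [surfaceMeasure, setIntegral_congr_fun (g := fun _ => 0) isClosed_frontier.measurableSet]
    · simp
    · intro x hx
      have := (hasTraceAt_of_eqOn (u := 0) (a := 0) (x := x) hΩ.measurableSet one_pos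
        fun _ _ => rfl).trace_eq hΩ (integrable_zero _ _ _) hx
      simp [this]
  rw [Jminus, h1, h2]
  simp

lemma memBV_zero : MemBV Ω 0 := ⟨integrable_zero _ _ _, by simp [totalVariation]⟩

lemma JF_neg_abs : JF Ω (fun _ s => -|s|) = Jminus Ω := by
  funext u
  rw [JF, Jminus, integral_neg, sub_eq_add_neg]

/-- Semicontinuity at `0` would give `J (v n) > c / 2` eventually, whereas `J (v n) ≤ c < c / 2`.
Invariance under a.e. equality lets `J` pass between functions and `L^1` classes. -/
lemma not_isLscBV_of_seq {J : (Euc (d + 1) → ℝ) → ℝ}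
    (hJ : ∀ u v, u =ᵐ[volume.restrict Ω] v → J u = J v) (hJ0 : J 0 = 0)
    {v : ℕ → Euc (d + 1) → ℝ} {c : ℝ} (hc : c < 0) (hv : ∀ n, Integrable (v n) (volume.restrict Ω))
    (hBV : ∀ᶠ n in atTop, MemBV Ω (v n)) (hvc : ∀ᶠ n in atTop, J (v n) ≤ c)
    (hlim : Tendsto (fun n => ∫ x in Ω, |v n x|) atTop (𝓝 0)) : ¬ IsLscBV Ω J := by
  intro hlsc
  have h0 : ((0 : Lp ℝ 1 (volume.restrict Ω)) : Euc (d + 1) → ℝ) =ᵐ[volume.restrict Ω] 0 :=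
    Lp.coeFn_zero _ _ _
  have h1 := hlsc 0 ((memBV_congr h0).2 memBV_zero) (c / 2) (by
    change c / 2 < J _
    rw [hJ _ _ h0, hJ0]
    linarith)
  have h2 : Tendsto (fun n => (hv n).toL1 (v n)) atTop (𝓝 0) := by
    rw [tendsto_zero_iff_norm_tendsto_zero]
    refine hlim.congr fun n => ?_
    rw [L1.norm_of_fun_eq_integral_norm]
    rfl
  have h3 : Tendsto (fun n => (hv n).toL1 (v n)) atTop
      (𝓝[{u : Lp ℝ 1 (volume.restrict Ω) | MemBV Ω u}] 0) := by
    refine tendsto_nhdsWithin_iff.2 ⟨h2, ?_⟩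
    filter_upwards [hBV] with n hn
    exact (memBV_congr (hv n).coeFn_toL1).2 hn
  obtain ⟨n, hn1, hn2⟩ := ((h3.eventually h1).and hvc).exists
  have : J ((hv n).toL1 (v n)) = J (v n) := hJ _ _ (hv n).coeFn_toL1
  have hn1 : c / 2 < J ((hv n).toL1 (v n)) := hn1
  linarith

lemma eventually_psi_lt (hα : 0 < α) (hη : 0 < η) {r : ℕ → ℝ} (hr : Tendsto r atTop (𝓝 0)) :
    ∀ᶠ n in atTop, psi α (r n) < η := by
  have h := ((continuous_psi hα).tendsto 0).comp hr
  rw [psi_zero hα] at h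
  exact h.eventually (gt_mem_nhds hη)

lemma IsModelDomain.tendsto_integral_capFun (hα0 : 0 < α) (hα1 : α < 1) (hd : 1 ≤ d)
    (hΩ : IsModelDomain α η Ω) {r : ℕ → ℝ} (hr0 : ∀ n, 0 < r n) (hr : Tendsto r atTop (𝓝 0)) :
    Tendsto (fun n => ∫ x in Ω, |capFun d α (r n) x|) atTop (𝓝 0) := by
  have h1 : Tendsto (fun n => omega d / ((d : ℝ) + 1 + α) * r n ^ (1 - α)) atTop (𝓝 0) := by
    have := (hr.rpow_const (p := 1 - α) (Or.inr (by linarith))).const_mul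
      (omega d / ((d : ℝ) + 1 + α))
    rwa [Real.zero_rpow (by linarith), mul_zero] at this
  refine h1.congr' ?_
  filter_upwards [eventually_psi_lt hα0 hΩ.pos hr] with n hn
  exact (hΩ.integral_abs_capFun hα0 hd (hr0 n) hn.le).symm

lemma IsModelDomain.isBigO_Jminus (hα : 0 < α) (hd : 1 ≤ d) (hΩ : IsModelDomain α η Ω)
    {r : ℕ → ℝ} (hr0 : ∀ n, 0 < r n) (hr : Tendsto r atTop (𝓝 0)) :
    (fun n => Jminus Ω (capFun d α (r n)) - (-((d : ℝ) * omega d / (2 * ((d : ℝ) + 2 * α)))))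
      =O[atTop] (fun n => r n ^ (2 * α)) := by
  refine Asymptotics.IsBigO.of_bound (d * omega d / (8 * (d + 4 * α))) ?_
  filter_upwards [eventually_psi_lt hα hΩ.pos hr] with n hn
  have := hr0 n
  rw [Real.norm_eq_abs, Real.norm_eq_abs, abs_of_nonneg (by positivity : 0 ≤ r n ^ (2 * α))]
  exact hΩ.abs_Jminus_capFun_sub_le hα hd (hr0 n) hn

lemma IsModelDomain.exists_Jminus_le (hα : 0 < α) (hd : 1 ≤ d) (hΩ : IsModelDomain α η Ω)
    {r : ℕ → ℝ} (hr0 : ∀ n, 0 < r n) (hr : Tendsto r atTop (𝓝 0)) :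
    ∃ c < 0, ∀ᶠ n in atTop, Jminus Ω (capFun d α (r n)) ≤ c := by
  have hω := omega_pos d
  have hd' : (0 : ℝ) < d := by exact_mod_cast hd
  set M := (d : ℝ) * omega d / (2 * ((d : ℝ) + 2 * α)) with hM
  have hM0 : 0 < M := by positivity
  have h1 : Tendsto (fun n => r n ^ (2 * α)) atTop (𝓝 0) := by
    have := hr.rpow_const (p := 2 * α) (Or.inr (by linarith))
    rwa [Real.zero_rpow (by linarith)] at this
  have h2 := (hΩ.isBigO_Jminus hα hd hr0 hr).trans_tendsto h1
  refine ⟨-M / 2, by linarith, ?_⟩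
  filter_upwards [h2.eventually (gt_mem_nhds (by linarith : 0 < M / 2))] with n hn
  linarith

lemma IsModelDomain.not_isLscBV_Jminus (hα0 : 0 < α) (hα1 : α < 1) (hd : 1 ≤ d)
    (hΩ : IsModelDomain α η Ω) : ¬ IsLscBV Ω (Jminus Ω) := by
  have hr0 : ∀ n : ℕ, 0 < 1 / ((n : ℝ) + 1) := fun n => by positivity
  have hr := tendsto_one_div_add_atTop_nhds_zero_nat (𝕜 := ℝ)
  obtain ⟨c, hc, hJ⟩ := hΩ.exists_Jminus_le hα0 hd hr0 hr
  refine not_isLscBV_of_seq (fun u v h => Jminus_congr h) (Jminus_zero hΩ.isC1.isOpen) hc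
    (fun n => (integrable_capFun hα0 hd (hr0 n)).integrableOn) ?_ hJ
    (hΩ.tendsto_integral_capFun hα0 hα1 hd hr0 hr)
  filter_upwards [eventually_psi_lt hα0 hΩ.pos hr] with n hn
  exact hΩ.memBV_capFun hα0 hd (hr0 n) hn

lemma not_modicaProperty (h : ¬ IsLscBV Ω (Jminus Ω)) : ¬ ModicaProperty Ω := by
  intro hM
  refine h (JF_neg_abs (Ω := Ω) ▸ hM (fun _ s => -|s|) (fun s => aestronglyMeasurable_const)
    (Eventually.of_forall fun x => continuous_abs.neg) (by simp)
    (Eventually.of_forall fun x s t => ?_))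
  rw [neg_sub_neg, abs_sub_comm s t]
  exact abs_abs_sub_abs_le t s

end

section

variable {d : ℕ} {α : ℝ}

/-! ### Sublevel sets with Hölder differentiable boundary -/

/-- The implicit function theorem with a Hölder condition on the derivative. -/
lemma exists_implicit_graph (hα : 0 ≤ α) {F : Euc d × ℝ → ℝ} (hF : ContDiff ℝ 1 F) (h0 : F 0 = 0)
    (hneg : fderiv ℝ F 0 (0, 1) < 0) {C₀ δ₀ : ℝ} (hδ₀ : 0 < δ₀) (hC₀ : 0 ≤ C₀)
    (hH : ∀ p ∈ ball (0 : Euc d × ℝ) δ₀, ∀ q ∈ ball (0 : Euc d × ℝ) δ₀,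
      ‖fderiv ℝ F p - fderiv ℝ F q‖ ≤ C₀ * ‖p - q‖ ^ α) :
    ∃ (f : Euc d → ℝ) (ρ C : ℝ), 0 < ρ ∧
      (∀ s ∈ ball (0 : Euc d) ρ, DifferentiableAt ℝ f s) ∧
      (∀ s ∈ ball (0 : Euc d) ρ, ∀ t ∈ ball (0 : Euc d) ρ,
        ‖fderiv ℝ f s - fderiv ℝ f t‖ ≤ C * ‖s - t‖ ^ α) ∧
      ∀ s t, ‖s‖ < ρ → |t| < ρ → (F (s, t) < 0 ↔ f s < t) := by
  have hinv : (fderiv ℝ F 0 ∘L .inr ℝ (Euc d) ℝ).IsInvertible := by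
    refine ⟨ContinuousLinearEquiv.unitsEquivAut ℝ (Units.mk0 _ hneg.ne), ?_⟩
    ext
    simp
  have cdf : ContDiffAt ℝ 1 F 0 := hF.contDiffAt
  set f := cdf.implicitFunction one_ne_zero hinv with hf
  have hf0 : f 0 = 0 := cdf.implicitFunction_apply_self one_ne_zero hinv
  have hfe : ∀ᶠ s in 𝓝 (0 : Euc d), F (s, f s) = 0 := by
    have := cdf.eventually_apply_implicitFunction one_ne_zero hinv
    rwa [h0] at this
  have hfc : ContDiffAt ℝ 1 f 0 := cdf.contDiffAt_implicitFunction one_ne_zero hinv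
  -- Half of the slope at the origin, so that the vertical derivative stays below `-m` in a
  -- neighbourhood.
  set m := -fderiv ℝ F 0 (0, 1) / 2 with hm
  have hm0 : 0 < m := by rw [hm]; linarith
  have hcont : Continuous fun p => fderiv ℝ F p (0, 1) :=
    (hF.continuous_fderiv one_ne_zero).clm_apply continuous_const
  obtain ⟨δ, hδ, hδ'⟩ : ∃ δ > 0, ∀ p ∈ ball (0 : Euc d × ℝ) δ,
      fderiv ℝ F p (0, 1) < -m ∧ p ∈ ball (0 : Euc d × ℝ) δ₀ := by
    refine Metric.eventually_nhds_iff_ball.1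
      ((hcont.continuousAt.eventually (gt_mem_nhds ?_)).and (ball_mem_nhds _ hδ₀))
    linarith
  set L := ‖fderiv ℝ f 0‖ + 1 with hL
  have hL0 : 0 ≤ L := by positivity
  obtain ⟨ρ₁, hρ₁, hρ₁'⟩ : ∃ ρ > 0, ∀ s ∈ ball (0 : Euc d) ρ, (∀ᶠ y in 𝓝 s, F (y, f y) = 0) ∧
      DifferentiableAt ℝ f s ∧ ‖fderiv ℝ f s‖ < L ∧ |f s| < δ := by
    refine Metric.eventually_nhds_iff_ball.1 ?_
    have h1 : ∀ᶠ s in 𝓝 (0 : Euc d), ContDiffAt ℝ 1 f s := hfc.eventually (by simp)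
    have h2 : ContinuousAt (fderiv ℝ f) 0 := hfc.continuousAt_fderiv one_ne_zero
    have h3 : ∀ᶠ s in 𝓝 (0 : Euc d), ‖fderiv ℝ f s‖ < L :=
      h2.norm.eventually (gt_mem_nhds (by rw [hL]; linarith))
    have h4 : ∀ᶠ s in 𝓝 (0 : Euc d), |f s| < δ :=
      hfc.continuousAt.abs.eventually (gt_mem_nhds (by simpa [hf0] using hδ))
    filter_upwards [hfe.eventually_nhds, h1, h3, h4] with s a1 a2 a3 a4
    exact ⟨a1, a2.differentiableAt one_ne_zero, a3, a4⟩
  set ρ := min ρ₁ δ with hρ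
  have hball : ∀ s ∈ ball (0 : Euc d) ρ, s ∈ ball (0 : Euc d) ρ₁ := fun s hs =>
    ball_subset_ball (min_le_left _ _) hs
  have hpt : ∀ s ∈ ball (0 : Euc d) ρ, ∀ t : ℝ, |t| < δ → (s, t) ∈ ball (0 : Euc d × ℝ) δ := by
    intro s hs t ht
    rw [mem_ball_zero_iff, Prod.norm_mk, max_lt_iff]
    exact ⟨(mem_ball_zero_iff.1 hs).trans_le (min_le_right _ _), ht⟩
  have hpf : ∀ s ∈ ball (0 : Euc d) ρ, (s, f s) ∈ ball (0 : Euc d × ℝ) δ := fun s hs =>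
    hpt s hs _ (hρ₁' s (hball s hs)).2.2.2
  -- Differentiate the identity `F(s, f s) = 0`.
  have hzero : ∀ s ∈ ball (0 : Euc d) ρ, ∀ v, fderiv ℝ F (s, f s) (v, fderiv ℝ f s v) = 0 := by
    intro s hs v
    obtain ⟨a1, a2, -, -⟩ := hρ₁' s (hball s hs)
    have h1 : HasFDerivAt (fun y => F (y, f y)) _ s :=
      (hF.differentiable one_ne_zero (s, f s)).hasFDerivAt.comp s
        ((hasFDerivAt_id s).prodMk a2.hasFDerivAt)
    have h2 : HasFDerivAt (fun y => F (y, f y)) (0 : Euc d →L[ℝ] ℝ) s :=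
      (hasFDerivAt_const (0 : ℝ) s).congr_of_eventuallyEq a1
    exact congrArg (fun T : Euc d →L[ℝ] ℝ => T v) (h1.unique h2)
  have hLip : ∀ s ∈ ball (0 : Euc d) ρ, ∀ t ∈ ball (0 : Euc d) ρ,
      ‖(s, f s) - (t, f t)‖ ≤ (1 + L) * ‖s - t‖ := by
    intro s hs t ht
    have h1 : ‖f s - f t‖ ≤ L * ‖s - t‖ :=
      (convex_ball (0 : Euc d) ρ).norm_image_sub_le_of_norm_fderiv_le (𝕜 := ℝ)
        (fun y hy => (hρ₁' y (hball y hy)).2.1) (fun y hy => (hρ₁' y (hball y hy)).2.2.1.le) ht hs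
    rw [Prod.mk_sub_mk, Prod.norm_mk, max_le_iff]
    constructor <;> nlinarith [mul_nonneg hL0 (norm_nonneg (s - t)), norm_nonneg (s - t)]
  refine ⟨f, ρ, C₀ * (1 + L) ^ α * (1 + L) / m, lt_min hρ₁ hδ,
    fun s hs => (hρ₁' s (hball s hs)).2.1, fun s hs t ht => ?_, fun s t hs ht => ?_⟩
  · refine ContinuousLinearMap.opNorm_le_bound _ (by positivity) fun v => ?_
    set p := (s, f s) with hp
    set q := (t, f t) with hq
    set w := fderiv ℝ f s v - fderiv ℝ f t v with hw
    -- Subtracting the differentiated identities at `p` and `q` moves the difference of the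
    -- derivatives of `f` onto that of `F`, which is Hölder; dividing by the slope bound `m`
    -- transfers the estimate.
    have h1 : fderiv ℝ F p (0, w) = (fderiv ℝ F q - fderiv ℝ F p) (v, fderiv ℝ f t v) := by
      have e : ((0 : Euc d), w) = (v, fderiv ℝ f s v) - (v, fderiv ℝ f t v) := by simp [hw]
      rw [e, map_sub, hzero s hs, sub_apply, hzero t ht]
    have h2 : fderiv ℝ F p (0, w) = w * fderiv ℝ F p (0, 1) := by
      have e : ((0 : Euc d), w) = w • ((0 : Euc d), (1 : ℝ)) := by simp
      rw [e, map_smul, smul_eq_mul]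
    have h3 : m * ‖w‖ ≤ ‖fderiv ℝ F p (0, w)‖ := by
      rw [h2, norm_mul, mul_comm]
      gcongr
      rw [Real.norm_eq_abs]
      exact (by linarith [(hδ' p (hpf s hs)).1] : m ≤ -fderiv ℝ F p (0, 1)).trans (neg_le_abs _)
    have h4 : ‖(v, fderiv ℝ f t v)‖ ≤ (1 + L) * ‖v‖ := by
      have := (fderiv ℝ f t).le_opNorm v
      have h5 := mul_le_mul_of_nonneg_right (hρ₁' t (hball t ht)).2.2.1.le (norm_nonneg v)
      rw [Prod.norm_mk, max_le_iff]
      constructor <;> nlinarith [mul_nonneg hL0 (norm_nonneg v), norm_nonneg v]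
    have h5 : ‖fderiv ℝ F q - fderiv ℝ F p‖ ≤ C₀ * ((1 + L) ^ α * ‖s - t‖ ^ α) := by
      rw [norm_sub_rev, ← Real.mul_rpow (by positivity) (norm_nonneg _)]
      refine (hH p (hδ' p (hpf s hs)).2 q (hδ' q (hpf t ht)).2).trans ?_
      gcongr
      exact hLip s hs t ht
    have h6 : m * ‖w‖ ≤ C₀ * ((1 + L) ^ α * ‖s - t‖ ^ α) * ((1 + L) * ‖v‖) := by
      refine h3.trans (h1 ▸ ((fderiv ℝ F q - fderiv ℝ F p).le_opNorm _).trans ?_)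
      gcongr
    rw [sub_apply, div_mul_eq_mul_div, div_mul_eq_mul_div, le_div_iff₀ hm0, mul_comm]
    exact h6.trans_eq (by ring)
  · have hs' : s ∈ ball (0 : Euc d) ρ := by simpa using hs
    -- On each vertical line `F` decreases strictly through its zero `f s`, so it is negative
    -- exactly above it.
    have hanti : StrictAntiOn (fun t => F (s, t)) (Ioo (-δ) δ) := by
      refine strictAntiOn_of_deriv_neg (convex_Ioo _ _)
        (hF.continuous.comp (continuous_const.prodMk continuous_id)).continuousOn fun t ht => ?_
      rw [interior_Ioo] at ht
      have h1 : HasDerivAt (fun t => F (s, t)) (fderiv ℝ F (s, t) (0, 1)) t :=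
        (hF.differentiable one_ne_zero (s, t)).hasFDerivAt.comp_hasDerivAt t
          ((hasDerivAt_const t s).prodMk (hasDerivAt_id t))
      rw [h1.deriv]
      linarith [(hδ' _ (hpt s hs' t (abs_lt.2 ht))).1]
    have h1 := (hρ₁' s (hball s hs'))
    have := hanti.lt_iff_gt (a := t) (b := f s)
      (abs_lt.1 (ht.trans_le (min_le_right _ _))) (abs_lt.1 h1.2.2.2)
    rw [← this, h1.1.self_of_nhds]

/-- Near a zero with nonvanishing derivative, the sublevel set of a function with Hölder
continuous derivative lies above a graph. -/
lemma exists_graph_of_sublevel (hα : 0 ≤ α) {G : Euc (d + 1) → ℝ} (hG : ContDiff ℝ 1 G)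
    {x₀ : Euc (d + 1)} (h0 : G x₀ = 0) (hne : fderiv ℝ G x₀ ≠ 0) {C₀ δ₀ : ℝ} (hδ₀ : 0 < δ₀)
    (hC₀ : 0 ≤ C₀) (hH : ∀ p ∈ ball x₀ δ₀, ∀ q ∈ ball x₀ δ₀,
      ‖fderiv ℝ G p - fderiv ℝ G q‖ ≤ C₀ * ‖p - q‖ ^ α) :
    ∃ (T : Euc (d + 1) ≃ᵃⁱ[ℝ] Euc (d + 1)) (f : Euc d → ℝ) (ρ C : ℝ),
      0 < ρ ∧ T x₀ = 0 ∧
      (∀ s ∈ ball (0 : Euc d) ρ, DifferentiableAt ℝ f s) ∧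
      (∀ s ∈ ball (0 : Euc d) ρ, ∀ t ∈ ball (0 : Euc d) ρ,
        ‖fderiv ℝ f s - fderiv ℝ f t‖ ≤ C * ‖s - t‖ ^ α) ∧
      (∀ x ∈ ball x₀ ρ, G x < 0 ↔ f (hor (T x)) < vert (T x)) := by
  set a : Euc (d + 1) := (InnerProductSpace.toDual ℝ (Euc (d + 1))).symm (fderiv ℝ G x₀) with ha
  have hinner : ∀ v, inner ℝ a v = fderiv ℝ G x₀ v := fun v =>
    InnerProductSpace.toDual_symm_apply
  have ha0 : a ≠ 0 := fun h => hne (by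
    rw [ha] at h
    exact (LinearIsometryEquiv.map_eq_zero_iff _).1 h)
  have han : 0 < ‖a‖ := norm_pos_iff.2 ha0
  -- The direction of steepest descent of `G`. The reflection in the bisecting hyperplane carries
  -- the vertical unit vector to it, so `G` decreases in the new vertical variable.
  set e : Euc (d + 1) := -(‖a‖⁻¹ • a) with he
  have hen : ‖(join 0 1 : Euc (d + 1))‖ = ‖e‖ := by
    rw [join_zero_one, he, norm_neg, norm_smul, norm_inv, norm_norm, inv_mul_cancel₀ han.ne']
    simp
  set Λ : Euc (d + 1) ≃ₗᵢ[ℝ] Euc (d + 1) :=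
    Submodule.reflection (ℝ ∙ ((join 0 1 : Euc (d + 1)) - e))ᗮ with hΛ
  have hΛe : Λ (join 0 1) = e := Submodule.reflection_sub hen
  set A : Euc d × ℝ →L[ℝ] Euc (d + 1) :=
    (Λ : Euc (d + 1) →L[ℝ] Euc (d + 1)).comp ((split d).symm : Euc d × ℝ →L[ℝ] Euc (d + 1))
    with hA
  have hAapp : ∀ p, A p = Λ (join p.1 p.2) := fun p => rfl
  have hAn : ∀ p, ‖A p‖ ≤ 2 * ‖p‖ := fun p => by
    rw [hAapp, LinearIsometryEquiv.norm_map]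
    refine (norm_join_le _ _).trans ?_
    have h1 := norm_fst_le p
    have h2 := norm_snd_le p
    rw [Real.norm_eq_abs] at h2
    linarith
  set F : Euc d × ℝ → ℝ := fun p => G (x₀ + A p) with hF
  have hFc : ContDiff ℝ 1 F := hG.comp (contDiff_const.add A.contDiff)
  have hF' : ∀ p, fderiv ℝ F p = (fderiv ℝ G (x₀ + A p)).comp A := fun p =>
    ((hG.differentiable one_ne_zero _).hasFDerivAt.comp p (A.hasFDerivAt.const_add x₀)).fderiv
  have hneg : fderiv ℝ F 0 (0, 1) < 0 := by
    rw [hF', map_zero, add_zero, ContinuousLinearMap.comp_apply, hAapp, hΛe, ← hinner, he,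
      inner_neg_right, inner_smul_right, real_inner_self_eq_norm_sq]
    have : 0 < ‖a‖⁻¹ * ‖a‖ ^ 2 := by positivity
    linarith
  have hAop : ‖A‖ ≤ 2 := A.opNorm_le_bound (by norm_num) hAn
  have hmem : ∀ p ∈ ball (0 : Euc d × ℝ) (δ₀ / 2), x₀ + A p ∈ ball x₀ δ₀ := fun p hp => by
    rw [mem_ball_iff_norm, add_sub_cancel_left]
    rw [mem_ball_zero_iff] at hp
    linarith [hAn p]
  -- Since `‖A‖ ≤ 2`, the change of variables costs `2 ^ α` in the distances and `2` in the chain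
  -- rule, and halves the radius.
  obtain ⟨f, ρ, C, hρ, h1, h2, h3⟩ := exists_implicit_graph (C₀ := C₀ * 2 ^ α * 2) (δ₀ := δ₀ / 2)
    hα hFc (by simpa [hF] using h0) hneg (by positivity) (by positivity) (fun p hp q hq => by
      rw [hF', hF', ← ContinuousLinearMap.sub_comp]
      refine (ContinuousLinearMap.opNorm_comp_le _ _).trans ?_
      have h4 := hH _ (hmem p hp) _ (hmem q hq)
      rw [add_sub_add_left_eq_sub, ← map_sub] at h4
      have h5 : ‖A (p - q)‖ ^ α ≤ 2 ^ α * ‖p - q‖ ^ α := by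
        rw [← Real.mul_rpow (by norm_num) (norm_nonneg _)]
        exact Real.rpow_le_rpow (norm_nonneg _) (hAn _) hα
      calc _ ≤ (C₀ * (2 ^ α * ‖p - q‖ ^ α)) * 2 := by
            gcongr
            exact h4.trans (by gcongr)
        _ = _ := by ring)
  refine ⟨(AffineIsometryEquiv.vaddConst ℝ x₀).symm.trans Λ.symm.toAffineIsometryEquiv, f, ρ, C,
    hρ, by simp, h1, h2, fun x hx => ?_⟩
  have hT : ((AffineIsometryEquiv.vaddConst ℝ x₀).symm.trans Λ.symm.toAffineIsometryEquiv) x =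
    Λ.symm (x - x₀) := by simp
  rw [hT]
  set z := Λ.symm (x - x₀) with hz
  have hzn : ‖z‖ < ρ := by
    rw [hz, LinearIsometryEquiv.norm_map]
    exact mem_ball_iff_norm.1 hx
  rw [← h3 _ _ ((norm_hor_le z).trans_lt hzn) ((abs_vert_le z).trans_lt hzn)]
  simp only [hF, hAapp, join_hor_vert]
  rw [hz, LinearIsometryEquiv.apply_symm_apply, add_sub_cancel]

end

section

variable {d : ℕ} {α : ℝ}

/-! ### Existence of model domains -/

lemma hasDerivAt_max_zero_sq (t : ℝ) : HasDerivAt (fun t : ℝ => max t 0 ^ 2) (2 * max t 0) t := by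
  rcases lt_trichotomy t 0 with h | rfl | h
  · have : (fun t : ℝ => max t 0 ^ 2) =ᶠ[𝓝 t] fun _ => 0 := by
      filter_upwards [gt_mem_nhds h] with y hy
      rw [max_eq_right hy.le]
      norm_num
    rw [max_eq_right h.le, mul_zero]
    exact (hasDerivAt_const t (0 : ℝ)).congr_of_eventuallyEq this
  · rw [max_self, mul_zero, hasDerivAt_iff_isLittleO_nhds_zero]
    have h1 : (fun h : ℝ => max (0 + h) 0 ^ 2 - max 0 0 ^ 2 - h • (0 : ℝ)) =O[𝓝 0]
        fun h : ℝ => h ^ 2 := by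
      refine Asymptotics.IsBigO.of_bound 1 (Eventually.of_forall fun h => ?_)
      rcases le_total h 0 with h' | h' <;> simp [h', sq_nonneg]
    exact h1.trans_isLittleO (Asymptotics.isLittleO_pow_id one_lt_two)
  · have : (fun t : ℝ => max t 0 ^ 2) =ᶠ[𝓝 t] fun t => t ^ 2 := by
      filter_upwards [lt_mem_nhds h] with y hy
      rw [max_eq_left hy.le]
    rw [max_eq_left h.le]
    simpa using (hasDerivAt_pow 2 t).congr_of_eventuallyEq this

/-- A convex function whose negative sublevel set is a model domain. -/
def modelFun (d : ℕ) (α : ℝ) (x : Euc (d + 1)) : ℝ :=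
  profile d α (hor x) + max (vert x - 1) 0 ^ 2 - vert x

lemma hasFDerivAt_modelFun (hα : 0 < α) (x : Euc (d + 1)) :
    HasFDerivAt (modelFun d α)
      ((profileDeriv d α (hor x)).comp (horL d) + (2 * max (vert x - 1) 0) • vertL d - vertL d)
      x := by
  have h1 := (hasFDerivAt_profile hα (hor x)).comp x (horL d).hasFDerivAt
  have h2 := (hasDerivAt_max_zero_sq (vert x - 1)).comp_hasFDerivAt x
    ((vertL d).hasFDerivAt.sub_const 1)
  exact (h1.add h2).sub (vertL d).hasFDerivAt

lemma norm_horL_le : ‖horL d‖ ≤ 1 :=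
  (horL d).opNorm_le_bound zero_le_one fun x => by simpa using norm_hor_le x

lemma norm_vertL_le : ‖vertL d‖ ≤ 1 :=
  (vertL d).opNorm_le_bound zero_le_one fun x => by simpa using abs_vert_le x

lemma norm_fderiv_modelFun_sub_le (hα0 : 0 < α) (hα1 : α < 1) (x y : Euc (d + 1)) :
    ‖fderiv ℝ (modelFun d α) x - fderiv ℝ (modelFun d α) y‖ ≤
      4 * ‖x - y‖ ^ α + 2 * ‖x - y‖ := by
  rw [(hasFDerivAt_modelFun hα0 x).fderiv, (hasFDerivAt_modelFun hα0 y).fderiv]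
  have e : (profileDeriv d α (hor x)).comp (horL d) + (2 * max (vert x - 1) 0) • vertL d - vertL d
      - ((profileDeriv d α (hor y)).comp (horL d) + (2 * max (vert y - 1) 0) • vertL d - vertL d)
      = (profileDeriv d α (hor x) - profileDeriv d α (hor y)).comp (horL d) +
        (2 * (max (vert x - 1) 0 - max (vert y - 1) 0)) • vertL d := by
    refine ContinuousLinearMap.ext fun v => ?_
    simp
    ring
  rw [e]
  refine (norm_add_le _ _).trans (add_le_add ?_ ?_)
  · refine (ContinuousLinearMap.opNorm_comp_le _ _).trans ?_
    refine (mul_le_of_le_one_right (norm_nonneg _) norm_horL_le).trans ?_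
    refine (norm_profileDeriv_sub_le hα0 hα1 _ _).trans ?_
    rw [← hor_sub]
    gcongr
    exact norm_hor_le _
  · rw [norm_smul]
    refine (mul_le_of_le_one_right (norm_nonneg _) norm_vertL_le).trans ?_
    rw [norm_mul, Real.norm_eq_abs, Real.norm_eq_abs, abs_two]
    gcongr
    refine (abs_max_sub_max_le_abs _ _ _).trans ?_
    rw [sub_sub_sub_cancel_right, ← vert_sub]
    exact abs_vert_le _

lemma contDiff_modelFun (hα0 : 0 < α) (hα1 : α < 1) : ContDiff ℝ 1 (modelFun d α) := by
  rw [contDiff_one_iff_fderiv]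
  refine ⟨fun x => (hasFDerivAt_modelFun hα0 x).differentiableAt, ?_⟩
  rw [continuous_iff_continuousAt]
  intro x
  rw [ContinuousAt, tendsto_iff_norm_sub_tendsto_zero]
  refine squeeze_zero (fun _ => norm_nonneg _)
    (fun y => norm_fderiv_modelFun_sub_le hα0 hα1 y x) ?_
  have : Continuous fun y : Euc (d + 1) => 4 * ‖y - x‖ ^ α + 2 * ‖y - x‖ := by
    have h : Continuous fun y : Euc (d + 1) => ‖y - x‖ := by fun_prop
    exact (continuous_const.mul (h.rpow_const fun _ => Or.inr hα0.le)).add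
      (continuous_const.mul h)
  simpa [Real.zero_rpow hα0.ne'] using this.tendsto x

/-- The only critical point has `x' = 0` and `x_N = 3/2`, where the value is `1/4 - 3/2 ≠ 0`. -/
lemma fderiv_modelFun_ne_zero (hα : 0 < α) {x : Euc (d + 1)} (hx : modelFun d α x = 0) :
    fderiv ℝ (modelFun d α) x ≠ 0 := by
  intro h
  rw [(hasFDerivAt_modelFun hα x).fderiv] at h
  have h1 : profileDeriv d α (hor x) = 0 := by
    ext v
    have := congrArg (fun T : Euc (d + 1) →L[ℝ] ℝ => T (join v 0)) h
    simpa using this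
  have h2 : hor x = 0 := by
    have := norm_profileDeriv hα (hor x)
    rw [h1, norm_zero, eq_comm, Real.rpow_eq_zero (norm_nonneg _) hα.ne'] at this
    exact norm_eq_zero.1 this
  have h3 : 2 * max (vert x - 1) 0 - 1 = 0 := by
    have := congrArg (fun T : Euc (d + 1) →L[ℝ] ℝ => T (join 0 1)) h
    simpa using this
  have h4 : vert x = 3 / 2 := by
    rcases le_total (vert x - 1) 0 with h | h
    · rw [max_eq_right h] at h3
      norm_num at h3
    · rw [max_eq_left h] at h3
      linarith
  rw [modelFun, h2, h4, profile, norm_zero, psi_zero hα] at hx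
  norm_num at hx

/-- Convexity is used to obtain connectedness of the sublevel set. -/
lemma convexOn_modelFun (hα : 0 < α) : ConvexOn ℝ univ (modelFun d α) := by
  have h1 : ConvexOn ℝ univ (profile d α) := by
    have h2 : ConvexOn ℝ univ fun s : Euc d => ‖s‖ ^ (1 + α) := by
      refine ⟨convex_univ, fun s _ t _ a b ha hb hab => ?_⟩
      refine le_trans ?_ ((convexOn_rpow (by linarith : 1 ≤ 1 + α)).2 (norm_nonneg s)
        (norm_nonneg t) ha hb hab)
      refine Real.rpow_le_rpow (norm_nonneg _) ?_ (by linarith)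
      exact convexOn_univ_norm.2 (mem_univ s) (mem_univ t) ha hb hab
    have h3 := h2.smul (by positivity : 0 ≤ (1 + α)⁻¹)
    refine h3.congr fun s _ => ?_
    simp only [profile_eq, smul_eq_mul]
    rw [div_eq_inv_mul]
  have h2 : ConvexOn ℝ univ fun x : Euc (d + 1) => profile d α (hor x) :=
    h1.comp_linearMap (horL d : Euc (d + 1) →ₗ[ℝ] Euc d)
  have h3' : ConvexOn ℝ univ fun t : ℝ => t - 1 :=
    (convexOn_id convex_univ).sub (concaveOn_const 1 convex_univ)
  have h3 : ConvexOn ℝ univ fun t : ℝ => max (t - 1) 0 :=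
    h3'.sup (convexOn_const 0 convex_univ)
  have h4 : ConvexOn ℝ univ fun t : ℝ => max (t - 1) 0 ^ 2 :=
    h3.pow (fun t _ => le_max_right _ _) 2
  have h5 : ConvexOn ℝ univ fun x : Euc (d + 1) => max (vert x - 1) 0 ^ 2 :=
    h4.comp_linearMap (vertL d : Euc (d + 1) →ₗ[ℝ] ℝ)
  have h6 : ConcaveOn ℝ univ fun x : Euc (d + 1) => vert x :=
    (vertL d : Euc (d + 1) →ₗ[ℝ] ℝ).concaveOn convex_univ
  exact (h2.add h5).sub h6

lemma exists_isModelDomain (hα0 : 0 < α) (hα1 : α < 1) :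
    ∃ (η : ℝ) (Ω : Set (Euc (d + 1))), IsModelDomain α η Ω := by
  have hc := contDiff_modelFun (d := d) hα0 hα1
  set Ω : Set (Euc (d + 1)) := {x | modelFun d α x < 0} with hΩ
  have hmem : ∀ x, x ∈ Ω ↔ modelFun d α x < 0 := fun x => Iff.rfl
  have hopen : IsOpen Ω := isOpen_lt hc.continuous continuous_const
  have hjoin : ∀ t : ℝ, t < 1 → modelFun d α (join 0 t) = -t := fun t ht => by
    rw [modelFun, hor_join, vert_join, profile, norm_zero, psi_zero hα0,
      max_eq_right (by linarith)]
    ring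
  -- Below height `1` the term `max (x_N - 1) 0 ^ 2` vanishes and the set is exactly the region
  -- above the profile.
  refine ⟨1, Ω, ⟨hopen, ⟨?_, ?_⟩, ?_, ?_⟩, ?_, one_pos, ?_⟩
  · refine ⟨join 0 (1 / 2), ?_⟩
    rw [hmem, hjoin _ (by norm_num)]
    norm_num
  · have := (convexOn_modelFun (d := d) hα0).convex_lt 0
    simp only [mem_univ, true_and] at this
    exact this.isPreconnected
  -- `9 = 3 + 6`: for `t ≥ 3` one has `(t - 1)² > t`, which forces `x_N < 3`; and `ψ(6) ≥ 6/2 = 3`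
  -- then forces `|x'| < 6`.
  · refine (isBounded_iff_forall_norm_le).2 ⟨9, fun x hx => ?_⟩
    rw [hmem, modelFun] at hx
    have h1 : 0 ≤ profile d α (hor x) := psi_nonneg hα0 _
    have h2 : 0 < vert x := by nlinarith [sq_nonneg (max (vert x - 1) 0)]
    have h3 : vert x < 3 := by
      by_contra h
      rw [max_eq_left (by linarith)] at hx
      nlinarith
    have h4 : psi α ‖hor x‖ < psi α 6 := by
      have h5 : (3 : ℝ) ≤ psi α 6 := by
        rw [psi, abs_of_pos (by norm_num), le_div_iff₀ (by linarith)]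
        calc 3 * (1 + α) ≤ 6 ^ (1 : ℝ) := by rw [Real.rpow_one]; linarith
          _ ≤ 6 ^ (1 + α) := by gcongr <;> linarith
      have h6 : psi α ‖hor x‖ < vert x := by
        have : profile d α (hor x) < vert x := by nlinarith [sq_nonneg (max (vert x - 1) 0)]
        exact this
      linarith
    rw [psi_lt_psi_iff hα0 (norm_nonneg _) (by norm_num)] at h4
    calc ‖x‖ = ‖join (hor x) (vert x)‖ := by rw [join_hor_vert]
      _ ≤ ‖hor x‖ + |vert x| := norm_join_le _ _
      _ ≤ 9 := by rw [abs_of_pos h2]; linarith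
  · intro x₀ hx₀
    have h0 : modelFun d α x₀ = 0 := frontier_lt_subset_eq hc.continuous continuous_const hx₀
    -- Radius `1/2` keeps `‖p - q‖ ≤ 1`, so the Lipschitz term is absorbed by the Hölder one and `6
    -- = 4 + 2`.
    refine exists_graph_of_sublevel hα0.le hc h0 (fderiv_modelFun_ne_zero hα0 h0) (C₀ := 6)
      (δ₀ := 1 / 2) (by norm_num) (by norm_num) fun p hp q hq => ?_
    refine (norm_fderiv_modelFun_sub_le hα0 hα1 p q).trans ?_
    have h1 : ‖p - q‖ ≤ 1 := by
      rw [← dist_eq_norm]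
      have := dist_triangle_right p q x₀
      rw [mem_ball] at hp hq
      linarith
    have h2 : ‖p - q‖ ≤ ‖p - q‖ ^ α := by
      have := Real.rpow_le_rpow_of_exponent_ge' (norm_nonneg (p - q)) h1 hα0.le hα1.le
      rwa [Real.rpow_one] at this
    linarith
  · rw [hopen.frontier_eq]
    have hj0 : join (0 : Euc d) 0 = 0 := by simpa using join_hor_vert (0 : Euc (d + 1))
    refine ⟨?_, fun h => ?_⟩
    · have h1 : Tendsto (fun t => join (0 : Euc d) t) (𝓝[>] 0) (𝓝 0) := by
        have : Continuous fun t => join (0 : Euc d) t := continuous_join continuous_const continuous_id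
        have := (this.tendsto 0).mono_left (nhdsWithin_le_nhds (s := Ioi 0))
        rwa [hj0] at this
      refine mem_closure_of_tendsto h1 ?_
      filter_upwards [Ioo_mem_nhdsGT one_pos] with t ht
      rw [hmem, hjoin t ht.2]
      linarith [ht.1]
    · rw [hmem, ← hj0, hjoin 0 one_pos] at h
      norm_num at h
  · ext x
    refine and_congr_left fun hx => ?_
    have hx' : vert x < 1 := hx
    rw [hmem, modelFun, max_eq_right (by linarith)]
    change profile d α (hor x) + 0 ^ 2 - vert x < 0 ↔ profile d α (hor x) < vert x
    constructor <;> intro h <;> linarith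

end

end BVTrace

end

theorem mainTheorem3 (d : ℕ) (hd : 1 ≤ d) (α : ℝ) (hα0 : 0 < α) (hα1 : α < 1) :
    (∃ (η : ℝ) (Ω : Set (BVTrace.Euc (d + 1))), BVTrace.IsModelDomain α η Ω) ∧
    ∀ (η : ℝ) (Ω : Set (BVTrace.Euc (d + 1))), BVTrace.IsModelDomain α η Ω →
      (∀ r : ℕ → ℝ, (∀ n, 0 < r n) → Tendsto r atTop (𝓝 0) →
        (∀ᶠ n in atTop, BVTrace.cap d α (r n) ⊆ Ω ∧
          BVTrace.MemBV Ω (BVTrace.capFun d α (r n)) ∧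
          (∀ᵐ x ∂(BVTrace.surfaceMeasure Ω),
            ∃ a, BVTrace.HasTraceAt Ω (BVTrace.capFun d α (r n)) x a) ∧
          Integrable (BVTrace.trace Ω (BVTrace.capFun d α (r n)))
            (BVTrace.surfaceMeasure Ω) ∧
          ∫ x in Ω, |BVTrace.capFun d α (r n) x| =
            BVTrace.omega d / ((d : ℝ) + 1 + α) * r n ^ (1 - α)) ∧
        Tendsto (fun n => ∫ x in Ω, |BVTrace.capFun d α (r n) x|) atTop (𝓝 0) ∧
        (fun n => BVTrace.Jminus Ω (BVTrace.capFun d α (r n)) -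
            (-((d : ℝ) * BVTrace.omega d / (2 * ((d : ℝ) + 2 * α)))))
          =O[atTop] (fun n => r n ^ (2 * α)) ∧
        ∃ c < 0, ∀ᶠ n in atTop, BVTrace.Jminus Ω (BVTrace.capFun d α (r n)) ≤ c) ∧
      ¬ BVTrace.IsLscBV Ω (BVTrace.Jminus Ω) ∧
      ¬ BVTrace.ModicaProperty Ω := by
  refine ⟨BVTrace.exists_isModelDomain hα0 hα1, fun η Ω hΩ => ⟨fun r hr0 hr => ?_,
    hΩ.not_isLscBV_Jminus hα0 hα1 hd,
    BVTrace.not_modicaProperty (hΩ.not_isLscBV_Jminus hα0 hα1 hd)⟩⟩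
  refine ⟨?_, hΩ.tendsto_integral_capFun hα0 hα1 hd hr0 hr, hΩ.isBigO_Jminus hα0 hd hr0 hr,
    hΩ.exists_Jminus_le hα0 hd hr0 hr⟩
  filter_upwards [BVTrace.eventually_psi_lt hα0 hΩ.pos hr] with n hn
  refine ⟨hΩ.cap_subset hn.le, hΩ.memBV_capFun hα0 hd (hr0 n) hn, ?_,
    hΩ.integrable_trace_capFun hα0 hd (hr0 n) hn, hΩ.integral_abs_capFun hα0 hd (hr0 n) hn.le⟩
  filter_upwards [hΩ.ae_vert_ne hα0 hd (hr0 n).le hn] with x hx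
  exact ⟨_, hΩ.hasTraceAt_capFun hn.le hx.2⟩
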